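/- **Setting.** Let $d\ge 1$, $k\ge 0$ be integers. Let $\psi:\{\text{finite multisets in }\mathbb R^d\}\to\mathbb R$ be measurable, and write $D_z(S)=\psi(S\cup\{z\})-\psi(S)$ (unions count multiplicities), $B_z(r)$ for the closed Euclidean ball, $cS=\{cx:x\in S\}$, and $d_{TV}(F,G)=\sup_A|F(A)-G(A)|$. For a probability distribution $G$ on $\mathbb R^d$ let $Y_1,Y_2,\dots,Y'$ be iid with law $G$ and let $\mathbf Y_n=\{Y_1,\dots,Y_n\}$ (as a multiset). For $p>2$, $M>0$ let $\mathcal C_{p,M}$ be the class of probability distributions on $\mathbb R^d$ that have a Lebesgue density $g$ with $\|g\|_p\le M$. * (E1) $\psi$ satisfies the *moment condition* on $\mathcal C_{p,M}$ if for some $a>2$ and $E_a<\infty$, $$\sup_{G\in\mathcal C_{p,M}}\sup_{n\ge1}\mathbb E\left|\psi\big(n^{1/d}(\mathbf Y_n\cup\{Y'\})\big)-\psi\big(n^{1/d}\mathbf Y_n\big)\right|^a\le E_a .$$ * (S1) $\psi$ satisfies the *uniform stabilization condition* for $\mathcal C_{p,M}$, $F\in\mathcal C_{p,M}$ and $b$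 if there are $(l_\epsilon)_{\epsilon>0}$ with $l_\epsilon\epsilon^b\to0$ as $\epsilon\to 0$ such that $$\sup_{G\in\mathcal C_{p,M},\ d_{TV}(F,G)\le\epsilon}\ \sup_{n\ge1}\ \mathbb P\left(D_{n^{1/d}Y'}\big((n^{1/d}\mathbf Y_n)\cap B_{n^{1/d}Y'}(l_\epsilon)\big)\ne D_{n^{1/d}Y'}\big(n^{1/d}\mathbf Y_n\big)\right)\longrightarrow0\quad(\epsilon\to0).$$ **Theorem.** Let $F$ be a probability distribution on $\mathbb R^d$ with density $f$, let $2<p<\infty$ and $\|f\|_p<M<\infty$. Let $X_1,X_2,\dots$ be iid with law $F$ and $\mathbf X_n=\{X_1,\dots,X_n\}$. For each $n\ge1$ let $\hat f_n$ be a density estimator, that is, a (jointly measurable) function of the sample $(X_1,\dots,X_n)$ and of the point $x\in\mathbb R^d$ which is almost surely a probability density in $x$, and let $\hat F_n$ be the distribution with density $\hat f_n$. Assume $\|\hat f_n-f\|_1\to0$ and $\|\hat f_n-f\|_p\to0$ in probability (resp. a.s.). Let $\vec\psi=(\psi_1,\dots,\psi_k)$ be a measurable $\mathbb R^k$-valued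 function on the finite multisets in $\mathbb R^d$, each of whose components satisfies (E1) on $\mathcal C_{p,M}$ and (S1) for $\mathcal C_{p,M}$, $F$ and $b=\frac{p-2}{d(p-1)}$. Let $(m_n)$ be a sequence of natural numbers with $m_n\to\infty$; conditionally on $\mathbf X_n$, let $\mathbf X^*_{m_n}$ be an iid sample of size $m_n$ from $\hat F_n$. Let $G$ be a probability distribution on $\mathbb R^k$. Put $$T_n=\frac1{\sqrt n}\left(\vec\psi\big(n^{1/d}\mathbf X_n\big)-\mathbb E\,\vec\psi\big(n^{1/d}\mathbf X_n\big)\right),\qquad T_n^*=\frac1{\sqrt{m_n}}\left(\vec\psi\big(m_n^{1/d}\mathbf X^*_{m_n}\big)-\mathbb E\left[\vec\psi\big(m_n^{1/d}\mathbf X^*_{m_n}\big)\,\middle|\,\mathbf X_n\right]\right).$$ Say that $T_n^*\to G$ in distribution in probability (resp. a.s.) if the conditional law of $T_n^*$ given $\mathbf X_n$ converges weakly to $G$ in probability (resp. almost surely). Then: 1. if $T_n\to G$ in distribution as $n\to\infty$, then $T_n^*\to G$ in distribution in probability (resp. a.s.); 2. $T_{m_n}\to G$ in distribution as $n\to\infty$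 if and only if $T_n^*\to G$ in distribution in probability (resp. a.s.); 3. if every sufficiently large integer is a value of the sequence $(m_n)$ (for example if $m_n=n$), then $T_n\to G$ in distribution if and only if $T_n^*\to G$ in distribution in probability (resp. a.s.). -/

import Mathlib

open MeasureTheory ProbabilityTheory Filter Topology
open scoped ENNReal BoundedContinuousFunction

noncomputable section

/-- The ambient space `ℝ^d` with its Euclidean norm and Lebesgue measure. -/
abbrev Pt (d : ℕ) : Type := EuclideanSpace ℝ (Fin d)

/-- The usual σ-algebra of point configurations on the finite multisets of a measurable space:
the one generated by the counting maps `S ↦ #(S ∩ B)`, with `B` measurable. -/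
instance multisetMeasurableSpace {α : Type*} [MeasurableSpace α] :
    MeasurableSpace (Multiset α) :=
  ⨆ B : {B : Set α // MeasurableSet B},
    MeasurableSpace.comap
      (fun S : Multiset α => (Multiset.map (fun x => (B : Set α).indicator (fun _ => (1 : ℕ)) x) S).sum)
      ⊤

/-- The multiset `{x_1, …, x_n}` (with multiplicities) of a finite sequence of points. -/
def toMultiset {α : Type*} {n : ℕ} (x : Fin n → α) : Multiset α :=
  Multiset.map x Finset.univ.val

/-- The rescaled point cloud `n^{1/d} S`. -/
def rescale {d : ℕ} (n : ℕ) (S : Multiset (Pt d)) : Multiset (Pt d) :=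
  S.map (fun x => ((n : ℝ) ^ (1 / (d : ℝ))) • x)

open Classical in
/-- The restriction `S ∩ B_z(r)` to the closed Euclidean ball, keeping multiplicities. -/
def restrictBall {d : ℕ} (S : Multiset (Pt d)) (z : Pt d) (r : ℝ) : Multiset (Pt d) :=
  S.filter (fun x => x ∈ Metric.closedBall z r)

/-- The add-one cost `D_z(S) = ψ(S ∪ {z}) - ψ(S)`. -/
def addOneCost {d : ℕ} (ψ : Multiset (Pt d) → ℝ) (z : Pt d) (S : Multiset (Pt d)) : ℝ :=
  ψ (z ::ₘ S) - ψ S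

/-- The measure with Lebesgue density `g`. -/
def densityMeasure {d : ℕ} (g : Pt d → ℝ) : Measure (Pt d) :=
  (volume : Measure (Pt d)).withDensity (fun x => ENNReal.ofReal (g x))

/-- `g` is a probability density on `ℝ^d`. -/
structure IsProbDensity {d : ℕ} (g : Pt d → ℝ) : Prop where
  measurable : Measurable g
  nonneg : ∀ x, 0 ≤ g x
  isProb : IsProbabilityMeasure (densityMeasure g)

/-- The class `C_{p,M}(ℝ^d)` of probability distributions with a density `g` such that
`‖g‖_p ≤ M`. -/
def densityClass (d : ℕ) (p M : ℝ) : Set (Measure (Pt d)) :=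
  {G | ∃ g : Pt d → ℝ, IsProbDensity g ∧ G = densityMeasure g ∧
    eLpNorm g (ENNReal.ofReal p) volume ≤ ENNReal.ofReal M}

/-- The closed ball of radius `ε` about `F` in the total variation distance
`d_TV(F, G) = sup_A |F(A) - G(A)|`. -/
def tvClosedBall {d : ℕ} (F : Measure (Pt d)) (ε : ℝ) : Set (Measure (Pt d)) :=
  {G | ∀ A : Set (Pt d), MeasurableSet A → |F.real A - G.real A| ≤ ε}

/-- The joint law of an iid sample `Y_1, …, Y_n` from `G` and an independent `Y' ∼ G`. -/
def sampleWithCopy {d : ℕ} (G : Measure (Pt d)) (n : ℕ) : Measure ((Fin n → Pt d) × Pt d) :=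
  (Measure.pi (fun _ : Fin n => G)).prod G

/-- The moment condition for `ψ` on a class `C` of distributions: for some `a > 2` the `a`-th
absolute moments of `ψ(n^{1/d}(Y_n ∪ {Y'})) - ψ(n^{1/d} Y_n)` are bounded, uniformly over
`G ∈ C` and `n ≥ 1`. -/
def MomentCondition {d : ℕ} (ψ : Multiset (Pt d) → ℝ) (C : Set (Measure (Pt d))) : Prop :=
  ∃ a : ℝ, 2 < a ∧ ∃ Ea : ℝ, ∀ G ∈ C, ∀ n : ℕ, 1 ≤ n →
    ∫⁻ y, ENNReal.ofReal
      (|ψ (rescale n (y.2 ::ₘ toMultiset y.1)) - ψ (rescale n (toMultiset y.1))| ^ a)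
      ∂(sampleWithCopy G n) ≤ ENNReal.ofReal Ea

/-- The uniform stabilization condition for `ψ`, `C`, `F` and `b`: for some radii `l_ε` with
`l_ε ε^b → 0`, the probability that the add-one cost at `n^{1/d} Y'` changes when
`n^{1/d} Y_n` is restricted to the ball of radius `l_ε` about `n^{1/d} Y'` tends to `0` as
`ε → 0`, uniformly over `n ≥ 1` and over the `G ∈ C` within total variation distance `ε`
of `F`. -/
def StabilizationCondition {d : ℕ} (ψ : Multiset (Pt d) → ℝ) (C : Set (Measure (Pt d)))
    (F : Measure (Pt d)) (b : ℝ) : Prop :=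
  ∃ l : ℝ → ℝ, Tendsto (fun ε : ℝ => l ε * ε ^ b) (𝓝[>] 0) (𝓝 0) ∧
    Tendsto
      (fun ε : ℝ => ⨆ G ∈ C ∩ tvClosedBall F ε, ⨆ n : ℕ, ⨆ _ : 1 ≤ n,
        sampleWithCopy G n
          {y | addOneCost ψ (((n : ℝ) ^ (1 / (d : ℝ))) • y.2)
                (restrictBall (rescale n (toMultiset y.1)) (((n : ℝ) ^ (1 / (d : ℝ))) • y.2) (l ε))
              ≠ addOneCost ψ (((n : ℝ) ^ (1 / (d : ℝ))) • y.2) (rescale n (toMultiset y.1))})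
      (𝓝[>] 0) (𝓝 (0 : ℝ≥0∞))

/-- The statistic `ψ⃗(n^{1/d} {x_1, …, x_n})`. -/
def scaledStat {d k : ℕ} (ψ : Multiset (Pt d) → (Fin k → ℝ)) (n : ℕ) (x : Fin n → Pt d) :
    Fin k → ℝ :=
  ψ (rescale n (toMultiset x))

/-- The first `n` observations `X_1, …, X_n` at the outcome `ω`. -/
def firstObs {Ω : Type*} {d : ℕ} (X : ℕ → Ω → Pt d) (n : ℕ) (ω : Ω) : Fin n → Pt d :=
  fun i => X i ω

/-- `n^{-1/2} (ψ⃗(n^{1/d} X_n) - E[ψ⃗(n^{1/d} X_n)])`, as a random vector. -/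
def centredStat {Ω : Type*} [MeasurableSpace Ω] (P : Measure Ω) {d k : ℕ}
    (ψ : Multiset (Pt d) → (Fin k → ℝ)) (X : ℕ → Ω → Pt d) (n : ℕ) (ω : Ω) : Fin k → ℝ :=
  (Real.sqrt n)⁻¹ •
    (scaledStat ψ n (firstObs X n ω) - ∫ ω', scaledStat ψ n (firstObs X n ω') ∂P)

/-- The law of `m^{-1/2} (ψ⃗(m^{1/d} Y_m) - E[ψ⃗(m^{1/d} Y_m)])` for an iid sample `Y_m` of size
`m` from `Q`. For `Q = F̂_n`, an estimate computed from `X_n`, this is the conditional law, given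
`X_n`, of the centred and normalized bootstrap statistic. -/
def bootstrapLaw {d k : ℕ} (ψ : Multiset (Pt d) → (Fin k → ℝ)) (m : ℕ) (Q : Measure (Pt d)) :
    Measure (Fin k → ℝ) :=
  (Measure.pi (fun _ : Fin m => Q)).map
    (fun y => (Real.sqrt m)⁻¹ •
      (scaledStat ψ m y - ∫ y', scaledStat ψ m y' ∂(Measure.pi (fun _ : Fin m => Q))))

/-- Weak convergence in probability of random laws `L_n` to `G`: the integral of every bounded
continuous function converges in probability. -/
def WeakConvInProb {Ω : Type*} [MeasurableSpace Ω] (P : Measure Ω) {k : ℕ}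
    (L : ℕ → Ω → Measure (Fin k → ℝ)) (G : Measure (Fin k → ℝ)) : Prop :=
  ∀ v : (Fin k → ℝ) →ᵇ ℝ,
    TendstoInMeasure P (fun n ω => ∫ y, v y ∂(L n ω)) atTop (fun _ => ∫ y, v y ∂G)

/-- Almost sure weak convergence of random laws `L_n` to `G`. -/
def WeakConvAlmostSurely {Ω : Type*} [MeasurableSpace Ω] (P : Measure Ω) {k : ℕ}
    (L : ℕ → Ω → Measure (Fin k → ℝ)) (G : Measure (Fin k → ℝ)) : Prop :=
  ∀ᵐ ω ∂P, ∀ v : (Fin k → ℝ) →ᵇ ℝ,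
    Tendsto (fun n => ∫ y, v y ∂(L n ω)) atTop (𝓝 (∫ y, v y ∂G))

/-- The `L_q` estimation error `‖f̂_n - f‖_q` at the outcome `ω`. -/
def estError {Ω : Type*} {d : ℕ} (X : ℕ → Ω → Pt d)
    (fhat : (n : ℕ) → (Fin n → Pt d) → Pt d → ℝ) (f : Pt d → ℝ) (q : ℝ) (n : ℕ) (ω : Ω) : ℝ≥0∞ :=
  eLpNorm (fun x => fhat n (firstObs X n ω) x - f x) (ENNReal.ofReal q) volume

/-- Convergence to `0` in probability for `[0, ∞]`-valued random variables. -/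
def TendstoZeroInProb {Ω : Type*} [MeasurableSpace Ω] (P : Measure Ω) (Z : ℕ → Ω → ℝ≥0∞) : Prop :=
  ∀ δ : ℝ, 0 < δ → Tendsto (fun n => P {ω | ENNReal.ofReal δ ≤ Z n ω}) atTop (𝓝 0)

/-- Almost sure convergence to `0` for `[0, ∞]`-valued random variables. -/
def TendstoZeroAlmostSurely {Ω : Type*} [MeasurableSpace Ω] (P : Measure Ω)
    (Z : ℕ → Ω → ℝ≥0∞) : Prop :=
  ∀ᵐ ω ∂P, Tendsto (fun n => Z n ω) atTop (𝓝 0)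

/-- The law of the bootstrap statistic with resample size `m_n` given `X_n`, as a random law. -/
def smoothedBootstrap {Ω : Type*} {d k : ℕ} (ψ : Multiset (Pt d) → (Fin k → ℝ))
    (X : ℕ → Ω → Pt d) (fhat : (n : ℕ) → (Fin n → Pt d) → Pt d → ℝ) (m : ℕ → ℕ)
    (n : ℕ) (ω : Ω) : Measure (Fin k → ℝ) :=
  bootstrapLaw ψ (m n) (densityMeasure (fhat n (firstObs X n ω)))

end

/-!
Let `π` couple the densities `f` and `g` so that `(X, Y) ∼ π` has `X ≠ Y` with probability at most
`ε = ‖f - g‖₁`, and take an iid sample of `n` pairs from `π`. The statistics `ψ(n^{1/d} X_n)` and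
`ψ(n^{1/d} Y_n)` differ by a variable of variance at most `n η(ε)`, with `η(ε) → 0` independent of
`n`; this uniformity in `n` is the whole point, since it makes the bootstrap law with resample size
`m_n` follow the true law with sample size `m_n`, whatever the rate of `f̂_n → f`.

For the variance bound (`exists_variance_modulus`), the Efron–Stein inequality
(`efronStein_lintegral`, derived by integrating a quadrilateral inequality) reduces it to
`E |D(X_n) - D(Y_n)|²` for the add-one costs `D` of one further pair `(X', Y')`. These costs have
bounded `a`-th moments with `a > 2`, so by Hölder's inequality it is enough that they agree with
probability tending to one. They agree unless `X' ≠ Y'`, or one of the two costs is not determined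
by the ball of radius `l_ε`, or some pair `X_i ≠ Y_i` comes within `l_ε n^{-1/d}` of `X'`
(`disagreementSet`). For the maximal coupling (`exists_maximal_coupling`) the last event has
probability at most `n ∫∫ f(x) |f - g|(y)` over the pairs at distance at most `l_ε n^{-1/d}`, which
by Hölder's inequality (`lintegral_near_pairs_le`) is at most a constant times
`l_ε^d ε^{(p - 2) / (p - 1)} = (l_ε ε^b)^d → 0` (`measure_disagreementSet_le`).

Consequently the normalized laws under `f` and `g` are uniformly close for Lipschitz test functions
(`exists_uniform_lipschitz_closeness`), and these determine weak convergence. A single filter,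
carrying both the index and the density, transfers weak limits between `f` and all nearby `g`
(`exists_uniform_weak_closeness`, `tendsto_bootstrapLaw_of_forall_exists_near`); the estimates
`f̂_n` are such `g` with probability tending to one, or eventually almost surely.
-/

/-! ### The Efron–Stein inequality without integrability -/

section EfronStein

variable {S : Type*} [MeasurableSpace S] (π : Measure S) [IsProbabilityMeasure π]

/-- Resampling one coordinate of an iid sample does not change its law. -/
lemma lintegral_pi_update {n : ℕ} (i : Fin n) {g : (Fin n → S) → ℝ≥0∞} (hg : Measurable g) :
    ∫⁻ z, ∫⁻ w, g (Function.update z i w) ∂π ∂(Measure.pi fun _ : Fin n => π)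
      = ∫⁻ z, g z ∂(Measure.pi fun _ : Fin n => π) := by
  obtain ⟨s⟩ : Nonempty S := nonempty_of_isProbabilityMeasure π
  have hK : Measurable fun z : Fin n → S => ∫⁻ w, g (Function.update z i w) ∂π := by
    apply Measurable.lintegral_prod_right'
      (f := fun q : (Fin n → S) × S => g (Function.update q.1 i q.2))
    fun_prop
  rw [lintegral_eq_lmarginal_univ (fun _ => s), lintegral_eq_lmarginal_univ (fun _ => s),
    lmarginal_erase' _ hK (Finset.mem_univ i), lmarginal_erase' _ hg (Finset.mem_univ i)]
  simp

/-- Exchanging one coordinate of an iid sample with an independent copy preserves the joint law. -/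
lemma lintegral_pi_swap_coordinate {n : ℕ} (i : Fin n) {g : (Fin n → S) × S → ℝ≥0∞}
    (hg : Measurable g) :
    ∫⁻ z, ∫⁻ w, g (Function.update z i w, z i) ∂π ∂(Measure.pi fun _ : Fin n => π)
      = ∫⁻ z, ∫⁻ w, g (z, w) ∂π ∂(Measure.pi fun _ : Fin n => π) := by
  have h1 : Measurable fun z : Fin n → S => ∫⁻ w, g (Function.update z i w, z i) ∂π := by
    apply Measurable.lintegral_prod_right'
      (f := fun q : (Fin n → S) × S => g (Function.update q.1 i q.2, q.1 i))
    fun_prop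
  have h2 : Measurable fun z : Fin n → S => ∫⁻ w, g (z, w) ∂π :=
    hg.lintegral_prod_right'
  rw [← lintegral_pi_update π i h1, ← lintegral_pi_update π i h2]
  refine lintegral_congr fun z => ?_
  simp only [Function.update_idem, Function.update_self]
  rw [lintegral_lintegral_swap]
  exact Measurable.aemeasurable (by fun_prop)

lemma lintegral_pi_succ {n : ℕ} {g : (Fin (n + 1) → S) → ℝ≥0∞} (hg : Measurable g) :
    ∫⁻ z, g z ∂(Measure.pi fun _ : Fin (n + 1) => π)
      = ∫⁻ x, ∫⁻ y, g (Fin.cons x y) ∂(Measure.pi fun _ : Fin n => π) ∂π := by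
  have h := (measurePreserving_piFinSuccAbove (fun _ : Fin (n + 1) => π) 0).symm
  rw [← h.lintegral_comp hg, lintegral_prod]
  · simp [MeasurableEquiv.piFinSuccAbove, Fin.insertNthEquiv]
  · exact (hg.comp (MeasurableEquiv.measurable _)).aemeasurable

/-- The squared diagonals of a quadrilateral with vertices `p`, `q`, `s`, `r` sum to at most the
sum of its squared sides. -/
lemma quadrilateral_sq_le (p q r s : ℝ) :
    ENNReal.ofReal ((p - s) ^ 2) + ENNReal.ofReal ((q - r) ^ 2) ≤
      (ENNReal.ofReal ((p - q) ^ 2) + ENNReal.ofReal ((r - s) ^ 2)) +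
        (ENNReal.ofReal ((p - r) ^ 2) + ENNReal.ofReal ((q - s) ^ 2)) := by
  rw [← ENNReal.ofReal_add, ← ENNReal.ofReal_add, ← ENNReal.ofReal_add, ← ENNReal.ofReal_add]
  · exact ENNReal.ofReal_le_ofReal (by nlinarith [sq_nonneg (p - q - r + s)])
  all_goals positivity

lemma lintegral_sq_sub_independent_le {T : Type*} [MeasurableSpace T] (ν : Measure T)
    [IsProbabilityMeasure ν] {u v : T → ℝ} (hu : Measurable u) (hv : Measurable v) :
    2 * ∫⁻ y, ∫⁻ y', ENNReal.ofReal ((u y - v y') ^ 2) ∂ν ∂ν ≤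
      ∫⁻ y, ∫⁻ y', ENNReal.ofReal ((u y - u y') ^ 2) ∂ν ∂ν +
      ∫⁻ y, ∫⁻ y', ENNReal.ofReal ((v y - v y') ^ 2) ∂ν ∂ν +
      2 * ∫⁻ y, ENNReal.ofReal ((u y - v y) ^ 2) ∂ν := by
  have hswap : ∫⁻ y, ∫⁻ y', ENNReal.ofReal ((u y' - v y) ^ 2) ∂ν ∂ν =
      ∫⁻ y, ∫⁻ y', ENNReal.ofReal ((u y - v y') ^ 2) ∂ν ∂ν :=
    lintegral_lintegral_swap (Measurable.aemeasurable (by fun_prop))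
  have hconst : ∫⁻ y, ∫⁻ _, ENNReal.ofReal ((u y - v y) ^ 2) ∂ν ∂ν =
      ∫⁻ y, ENNReal.ofReal ((u y - v y) ^ 2) ∂ν := by simp
  have hconst' : ∫⁻ _, ∫⁻ y', ENNReal.ofReal ((u y' - v y') ^ 2) ∂ν ∂ν =
      ∫⁻ y, ENNReal.ofReal ((u y - v y) ^ 2) ∂ν := by simp
  have hadd {A B : T × T → ℝ≥0∞} (hA : Measurable A) :
      ∫⁻ y, ∫⁻ y', A (y, y') + B (y, y') ∂ν ∂ν =
        ∫⁻ y, ∫⁻ y', A (y, y') ∂ν ∂ν + ∫⁻ y, ∫⁻ y', B (y, y') ∂ν ∂ν := by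
    rw [← lintegral_add_left hA.lintegral_prod_right']
    exact lintegral_congr fun y => lintegral_add_left (hA.comp measurable_prodMk_left) _
  have hle : ∫⁻ y, ∫⁻ y', (ENNReal.ofReal ((u y - v y') ^ 2) +
        ENNReal.ofReal ((u y' - v y) ^ 2)) ∂ν ∂ν ≤
      ∫⁻ y, ∫⁻ y', ((ENNReal.ofReal ((u y - u y') ^ 2) + ENNReal.ofReal ((v y - v y') ^ 2)) +
        (ENNReal.ofReal ((u y - v y) ^ 2) + ENNReal.ofReal ((u y' - v y') ^ 2))) ∂ν ∂ν :=
    lintegral_mono fun y => lintegral_mono fun y' =>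
      quadrilateral_sq_le (u y) (u y') (v y) (v y')
  rw [hadd (A := fun q => ENNReal.ofReal ((u q.1 - v q.2) ^ 2))
      (B := fun q => ENNReal.ofReal ((u q.2 - v q.1) ^ 2)) (by fun_prop),
    hadd (A := fun q => ENNReal.ofReal ((u q.1 - u q.2) ^ 2) + ENNReal.ofReal ((v q.1 - v q.2) ^ 2))
      (B := fun q => ENNReal.ofReal ((u q.1 - v q.1) ^ 2) +
        ENNReal.ofReal ((u q.2 - v q.2) ^ 2)) (by fun_prop),
    hadd (A := fun q => ENNReal.ofReal ((u q.1 - u q.2) ^ 2))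
      (B := fun q => ENNReal.ofReal ((v q.1 - v q.2) ^ 2)) (by fun_prop),
    hadd (A := fun q => ENNReal.ofReal ((u q.1 - v q.1) ^ 2))
      (B := fun q => ENNReal.ofReal ((u q.2 - v q.2) ^ 2)) (by fun_prop),
    hswap, hconst, hconst'] at hle
  simpa only [two_mul] using hle

/-- The Efron–Stein inequality for two independent blocks: the quadrilateral inequality integrated
over `h x y`, `h x y'`, `h x' y`, `h x' y'`. -/
lemma lintegral_sq_sub_prod_le {T : Type*} [MeasurableSpace T] (ν : Measure T)
    [IsProbabilityMeasure ν] {h : S → T → ℝ} (hh : Measurable fun q : S × T => h q.1 q.2) :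
    ∫⁻ x, ∫⁻ y, ∫⁻ x', ∫⁻ y', ENNReal.ofReal ((h x y - h x' y') ^ 2) ∂ν ∂π ∂ν ∂π ≤
      ∫⁻ x, ∫⁻ y, ∫⁻ x', ENNReal.ofReal ((h x y - h x' y) ^ 2) ∂π ∂ν ∂π +
      ∫⁻ x, ∫⁻ y, ∫⁻ y', ENNReal.ofReal ((h x y - h x y') ^ 2) ∂ν ∂ν ∂π := by
  set V : S → ℝ≥0∞ := fun x => ∫⁻ y, ∫⁻ y', ENNReal.ofReal ((h x y - h x y') ^ 2) ∂ν ∂ν with hV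
  set W : S → S → ℝ≥0∞ := fun x x' => ∫⁻ y, ENNReal.ofReal ((h x y - h x' y) ^ 2) ∂ν with hW
  set J : S → S → ℝ≥0∞ :=
    fun x x' => ∫⁻ y, ∫⁻ y', ENNReal.ofReal ((h x y - h x' y') ^ 2) ∂ν ∂ν with hJ
  have hsec (x : S) : Measurable (h x) := hh.comp measurable_prodMk_left
  have hVm : Measurable V := by
    refine Measurable.lintegral_prod_right' (f := fun q : S × T =>
      ∫⁻ y', ENNReal.ofReal ((h q.1 q.2 - h q.1 y') ^ 2) ∂ν) ?_
    refine Measurable.lintegral_prod_right' (f := fun q : (S × T) × T =>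
      ENNReal.ofReal ((h q.1.1 q.1.2 - h q.1.1 q.2) ^ 2)) ?_
    have h1 : Measurable fun q : (S × T) × T => h q.1.1 q.1.2 := hh.comp measurable_fst
    have h2 : Measurable fun q : (S × T) × T => h q.1.1 q.2 :=
      hh.comp (measurable_fst.fst.prodMk measurable_snd)
    fun_prop
  have hWm : Measurable fun q : S × S => W q.1 q.2 := by
    refine Measurable.lintegral_prod_right' (f := fun q : (S × S) × T =>
      ENNReal.ofReal ((h q.1.1 q.2 - h q.1.2 q.2) ^ 2)) ?_
    have h1 : Measurable fun q : (S × S) × T => h q.1.1 q.2 :=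
      hh.comp (measurable_fst.fst.prodMk measurable_snd)
    have h2 : Measurable fun q : (S × S) × T => h q.1.2 q.2 :=
      hh.comp (measurable_fst.snd.prodMk measurable_snd)
    fun_prop
  have key (x x' : S) : 2 * J x x' ≤ V x + V x' + 2 * W x x' :=
    lintegral_sq_sub_independent_le ν (hsec x) (hsec x')
  calc ∫⁻ x, ∫⁻ y, ∫⁻ x', ∫⁻ y', ENNReal.ofReal ((h x y - h x' y') ^ 2) ∂ν ∂π ∂ν ∂π
      = ∫⁻ x, ∫⁻ x', J x x' ∂π ∂π := by
        refine lintegral_congr fun x => ?_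
        rw [lintegral_lintegral_swap]
        refine (Measurable.lintegral_prod_right' (f := fun q : (T × S) × T =>
          ENNReal.ofReal ((h x q.1.1 - h q.1.2 q.2) ^ 2)) ?_).aemeasurable
        have h1 : Measurable fun q : (T × S) × T => h x q.1.1 :=
          (hsec x).comp measurable_fst.fst
        have h2 : Measurable fun q : (T × S) × T => h q.1.2 q.2 :=
          hh.comp (measurable_fst.snd.prodMk measurable_snd)
        fun_prop
    _ ≤ ∫⁻ x, ∫⁻ x', W x x' ∂π ∂π + ∫⁻ x, V x ∂π := by
        have h2 : 2 * ∫⁻ x, ∫⁻ x', J x x' ∂π ∂π ≤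
            2 * (∫⁻ x, ∫⁻ x', W x x' ∂π ∂π + ∫⁻ x, V x ∂π) := by
          calc 2 * ∫⁻ x, ∫⁻ x', J x x' ∂π ∂π
              = ∫⁻ x, ∫⁻ x', 2 * J x x' ∂π ∂π := by
                rw [← lintegral_const_mul' _ _ (by simp)]
                exact lintegral_congr fun x => (lintegral_const_mul' _ _ (by simp)).symm
            _ ≤ ∫⁻ x, ∫⁻ x', (V x + V x' + 2 * W x x') ∂π ∂π :=
                lintegral_mono fun x => lintegral_mono fun x' => key x x'
            _ = ∫⁻ x, (V x + ∫⁻ x', V x' ∂π + 2 * ∫⁻ x', W x x' ∂π) ∂π := by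
                refine lintegral_congr fun x => ?_
                rw [lintegral_add_left (by fun_prop), lintegral_add_left (by fun_prop),
                  lintegral_const_mul' _ _ (by simp)]
                simp
            _ = 2 * (∫⁻ x, ∫⁻ x', W x x' ∂π ∂π + ∫⁻ x, V x ∂π) := by
                rw [lintegral_add_left (by fun_prop), lintegral_add_left (by fun_prop),
                  lintegral_const_mul' _ _ (by simp)]
                simp only [lintegral_const, measure_univ, mul_one]
                ring
        exact (ENNReal.mul_le_mul_iff_right two_ne_zero ENNReal.ofNat_ne_top).1 h2
    _ = _ := by
        congr 1
        refine lintegral_congr fun x => ?_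
        rw [lintegral_lintegral_swap]
        have := hsec x
        refine Measurable.aemeasurable ?_
        have h1 : Measurable fun q : S × T => h q.1 q.2 := hh
        have h2 : Measurable fun q : S × T => h x q.2 := (hsec x).comp measurable_snd
        simp only [Function.uncurry_def]
        fun_prop

/-- The Efron–Stein inequality, with the variance replaced by half the mean squared difference of
two independent copies. In this form it needs no integrability of `h`: both sides may be infinite. -/
lemma efronStein_lintegral {n : ℕ} {h : (Fin n → S) → ℝ} (hh : Measurable h) :
    ∫⁻ z, ∫⁻ z', ENNReal.ofReal ((h z - h z') ^ 2) ∂(Measure.pi fun _ : Fin n => π)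
        ∂(Measure.pi fun _ : Fin n => π) ≤
      ∑ i, ∫⁻ z, ∫⁻ w, ENNReal.ofReal ((h z - h (Function.update z i w)) ^ 2) ∂π
        ∂(Measure.pi fun _ : Fin n => π) := by
  induction n with
  | zero => simp [Subsingleton.elim _ (default : Fin 0 → S)]
  | succ n ih =>
    have hcons : Measurable fun q : S × (Fin n → S) => (Fin.cons q.1 q.2 : Fin (n + 1) → S) :=
      measurable_pi_lambda _ fun i => by
        refine Fin.cases ?_ (fun j => ?_) i
        · simpa using measurable_fst
        · simp only [Fin.cons_succ]
          exact (measurable_pi_apply j).comp measurable_snd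
    have hh' : Measurable fun q : S × (Fin n → S) => h (Fin.cons q.1 q.2) := hh.comp hcons
    have hupd (i : Fin (n + 1)) : Measurable fun z : Fin (n + 1) → S =>
        ∫⁻ w, ENNReal.ofReal ((h z - h (Function.update z i w)) ^ 2) ∂π := by
      refine Measurable.lintegral_prod_right' (f := fun q : (Fin (n + 1) → S) × S =>
        ENNReal.ofReal ((h q.1 - h (Function.update q.1 i q.2)) ^ 2)) ?_
      fun_prop
    have hdbl : Measurable fun z : Fin (n + 1) → S =>
        ∫⁻ z', ENNReal.ofReal ((h z - h z') ^ 2) ∂(Measure.pi fun _ : Fin (n + 1) => π) := by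
      refine Measurable.lintegral_prod_right' (f := fun q : (Fin (n + 1) → S) × _ =>
        ENNReal.ofReal ((h q.1 - h q.2) ^ 2)) ?_
      fun_prop
    rw [lintegral_pi_succ π hdbl, Fin.sum_univ_succ]
    have hinner (z : Fin (n + 1) → S) := lintegral_pi_succ π
      (g := fun z' => ENNReal.ofReal ((h z - h z') ^ 2)) (by fun_prop)
    simp_rw [hinner, lintegral_pi_succ π (hupd _), ← Fin.cons_update, Fin.update_cons_zero]
    refine (lintegral_sq_sub_prod_le π (Measure.pi fun _ : Fin n => π)
      (h := fun x y => h (Fin.cons x y)) hh').trans ?_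
    gcongr
    calc _ ≤ ∫⁻ x, ∑ i, ∫⁻ y, ∫⁻ w, ENNReal.ofReal ((h (Fin.cons x y) -
          h (Fin.cons x (Function.update y i w))) ^ 2) ∂π
            ∂(Measure.pi fun _ : Fin n => π) ∂π :=
          lintegral_mono fun x => ih (h := fun y => h (Fin.cons x y))
            (hh'.comp measurable_prodMk_left)
      _ = _ := by
        rw [lintegral_finsetSum' _ fun i _ => Measurable.aemeasurable ?_]
        have hi := (hupd i.succ).comp hcons
        refine Measurable.lintegral_prod_right' (ν := Measure.pi fun _ : Fin n => π)
          (f := fun q : S × (Fin n → S) => ∫⁻ w, ENNReal.ofReal ((h (Fin.cons q.1 q.2) -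
            h (Fin.cons q.1 (Function.update q.2 i w))) ^ 2) ∂π) ?_
        simpa [Function.comp_def, ← Fin.cons_update] using hi

/-- Efron–Stein for a statistic `h` whose change under resampling one coordinate is the difference
of two add-one costs `K`, both added to samples of the full size `n`. -/
lemma lintegral_sq_sub_le_of_addOne {n : ℕ} {h : (Fin n → S) → ℝ} (hh : Measurable h)
    {K : (Fin n → S) × S → ℝ} (hK : Measurable K)
    (hhK : ∀ z i w, h z - h (Function.update z i w) = K (Function.update z i w, z i) - K (z, w)) :
    ∫⁻ z, ∫⁻ z', ENNReal.ofReal ((h z - h z') ^ 2) ∂(Measure.pi fun _ : Fin n => π)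
        ∂(Measure.pi fun _ : Fin n => π) ≤
      4 * n * ∫⁻ q, ENNReal.ofReal (K q ^ 2) ∂((Measure.pi fun _ : Fin n => π).prod π) := by
  have hK2 : Measurable fun q => ENNReal.ofReal (K q ^ 2) := by fun_prop
  refine (efronStein_lintegral π hh).trans ?_
  rw [lintegral_prod _ hK2.aemeasurable]
  set I := ∫⁻ z, ∫⁻ w, ENNReal.ofReal (K (z, w) ^ 2) ∂π ∂(Measure.pi fun _ : Fin n => π) with hI
  have hbound (i : Fin n) : ∫⁻ z, ∫⁻ w, ENNReal.ofReal ((h z - h (Function.update z i w)) ^ 2) ∂π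
        ∂(Measure.pi fun _ : Fin n => π) ≤ 4 * I := by
    calc _ ≤ ∫⁻ z, ∫⁻ w, (2 * ENNReal.ofReal (K (Function.update z i w, z i) ^ 2) +
            2 * ENNReal.ofReal (K (z, w) ^ 2)) ∂π ∂(Measure.pi fun _ : Fin n => π) := by
          refine lintegral_mono fun z => lintegral_mono fun w => ?_
          rw [hhK, ← ENNReal.ofReal_ofNat 2, ← ENNReal.ofReal_mul (by norm_num),
            ← ENNReal.ofReal_mul (by norm_num), ← ENNReal.ofReal_add (by positivity)
              (by positivity)]
          refine ENNReal.ofReal_le_ofReal ?_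
          nlinarith [sq_nonneg (K (Function.update z i w, z i) + K (z, w))]
      _ = 2 * ∫⁻ z, ∫⁻ w, ENNReal.ofReal (K (Function.update z i w, z i) ^ 2) ∂π
            ∂(Measure.pi fun _ : Fin n => π) + 2 * I := by
          have h1 : Measurable fun q : (Fin n → S) × S =>
            ENNReal.ofReal (K (Function.update q.1 i q.2, q.1 i) ^ 2) := hK2.comp (by fun_prop)
          rw [hI, ← lintegral_const_mul' _ _ (by simp), ← lintegral_const_mul' _ _ (by simp),
            ← lintegral_add_left (by exact (h1.lintegral_prod_right').const_mul 2)]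
          refine lintegral_congr fun z => ?_
          rw [← lintegral_const_mul' _ _ (by simp), ← lintegral_const_mul' _ _ (by simp),
            lintegral_add_left (by exact (h1.comp measurable_prodMk_left).const_mul 2)]
      _ = 4 * I := by
          rw [lintegral_pi_swap_coordinate π i hK2, ← hI]
          ring
  calc _ ≤ ∑ _ : Fin n, 4 * I := Finset.sum_le_sum fun i _ => hbound i
    _ = 4 * n * I := by
      simp only [Finset.sum_const, Finset.card_univ, Fintype.card_fin, nsmul_eq_mul]
      ring

/-- A finite mean squared difference of two independent copies already gives square integrability:
some value of the second copy leaves a finite second moment for the first. -/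
lemma memLp_two_and_integral_abs_sub_le {h : S → ℝ} (hh : Measurable h) {C : ℝ}
    (hC : ∫⁻ z, ∫⁻ z', ENNReal.ofReal ((h z - h z') ^ 2) ∂π ∂π ≤ ENNReal.ofReal C) :
    MemLp h 2 π ∧ ∫ z, |h z - ∫ z', h z' ∂π| ∂π ≤ √C := by
  obtain ⟨z₀, hz₀⟩ := exists_le_lintegral (μ := π)
    (f := fun z => ∫⁻ z', ENNReal.ofReal ((h z - h z') ^ 2) ∂π) 
    (Measurable.lintegral_prod_right' (f := fun q : S × S => ENNReal.ofReal ((h q.1 - h q.2) ^ 2))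
      (by fun_prop)).aemeasurable
  set c := h z₀
  have hle : ∫⁻ z, ENNReal.ofReal ((h z - c) ^ 2) ∂π ≤ ENNReal.ofReal C := by
    refine le_trans (le_of_eq ?_) (hz₀.trans hC)
    refine lintegral_congr fun z => ?_
    rw [← neg_sub, neg_sq]
  have hint : Integrable (fun z => (h z - c) ^ 2) π := by
    refine ⟨by fun_prop, ?_⟩
    rw [hasFiniteIntegral_iff_ofReal (ae_of_all _ fun z => sq_nonneg _)]
    exact hle.trans_lt ENNReal.ofReal_lt_top
  have hLc : MemLp (fun z => h z - c) 2 π :=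
    (memLp_two_iff_integrable_sq (by fun_prop)).2 hint
  have hL : MemLp h 2 π := by
    simpa [Pi.add_def] using hLc.add (memLp_const c)
  refine ⟨hL, ?_⟩
  have hint' : Integrable h π := hL.integrable (by norm_num)
  set e := ∫ z', h z' ∂π with he
  have hLe : MemLp (fun z => |h z - e|) 2 π := (hL.sub (memLp_const e)).abs
  have hvar : Var[h; π] ≤ max C 0 := by
    calc Var[h; π] = Var[fun z => h z - c; π] := (variance_sub_const hh.aestronglyMeasurable c).symm
      _ ≤ ∫ z, (h z - c) ^ 2 ∂π := variance_le_expectation_sq (by fun_prop)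
      _ ≤ max C 0 := by
        rw [integral_eq_lintegral_of_nonneg_ae (ae_of_all _ fun z => sq_nonneg _) (by fun_prop)]
        refine ENNReal.toReal_le_of_le_ofReal (le_max_right _ _) (hle.trans ?_)
        exact ENNReal.ofReal_le_ofReal (le_max_left _ _)
  have h0 := variance_nonneg (fun z => |h z - e|) π
  rw [variance_eq_sub hLe] at h0
  have h1 : ∫ z, ((fun z => |h z - e|) ^ 2) z ∂π = Var[h; π] := by
    rw [variance_eq_integral hh.aemeasurable]
    simp [sq_abs, he]
  have : √C = √(max C 0) := by
    rcases le_total C 0 with hC0 | hC0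
    · rw [max_eq_right hC0, Real.sqrt_eq_zero_of_nonpos hC0, Real.sqrt_zero]
    · rw [max_eq_left hC0]
  rw [this]
  refine Real.le_sqrt_of_sq_le ?_
  linarith

end EfronStein

/-! ### Maximal couplings -/

section Coupling

variable {α : Type*} [MeasurableSpace α]

/-- When `e = 0` the measure is zero, so that the value `0⁻¹ = ∞` does no harm. -/
lemma inv_smul_smul_measure_univ (ρ : Measure α) {e : ℝ≥0∞} (he : ρ Set.univ = e) (he' : e ≠ ∞) :
    e⁻¹ • (e • ρ) = ρ := by
  rcases eq_or_ne e 0 with rfl | h0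
  · simp [Measure.measure_univ_eq_zero.1 he]
  · rw [smul_smul, ENNReal.inv_mul_cancel h0 he', one_smul]

/-- The maximal coupling: the common part `min f g` sits on the diagonal, and the excess parts
`f - g` and `g - f`, of equal mass `e`, are coupled independently. -/
theorem exists_maximal_coupling [MeasurableEq α] (μ : Measure α) [SFinite μ] {f g : α → ℝ≥0∞}
    (hf : Measurable f) (hg : Measurable g) [IsProbabilityMeasure (μ.withDensity f)]
    [IsProbabilityMeasure (μ.withDensity g)] :
    ∃ π : Measure (α × α), π.map Prod.fst = μ.withDensity f ∧ π.map Prod.snd = μ.withDensity g ∧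
      ∀ B : Set α, MeasurableSet B →
        π ({z | z.1 ≠ z.2} ∩ Prod.fst ⁻¹' B) ≤ ∫⁻ x in B, f x - g x ∂μ ∧
        π ({z | z.1 ≠ z.2} ∩ Prod.snd ⁻¹' B) ≤ ∫⁻ x in B, g x - f x ∂μ := by
  set ρ₁ := μ.withDensity (fun x => f x - g x) with hρ₁
  set ρ₂ := μ.withDensity (fun x => g x - f x) with hρ₂
  set ν := μ.withDensity (fun x => min (f x) (g x)) with hν
  have hfe : ν + ρ₁ = μ.withDensity f := by
    rw [hν, hρ₁, ← withDensity_add_left (hf.min hg)]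
    congr 1 with x
    simpa [add_comm] using tsub_add_min (a := f x) (b := g x)
  have hge : ν + ρ₂ = μ.withDensity g := by
    rw [hν, hρ₂, ← withDensity_add_left (hf.min hg)]
    congr 1 with x
    simpa [add_comm, min_comm] using tsub_add_min (a := g x) (b := f x)
  have hm₁ : ν Set.univ + ρ₁ Set.univ = 1 := by
    rw [← Measure.add_apply, hfe, measure_univ]
  have hm₂ : ν Set.univ + ρ₂ Set.univ = 1 := by
    rw [← Measure.add_apply, hge, measure_univ]
  set e := ρ₁ Set.univ with he
  have hνfin : ν Set.univ ≠ ∞ := fun h => by simp [h] at hm₁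
  have hefin : e ≠ ∞ := fun h => by simp [h] at hm₁
  have he₂ : ρ₂ Set.univ = e := by
    rw [← hm₂] at hm₁
    exact ((ENNReal.add_right_inj hνfin).1 hm₁).symm
  have hoff : MeasurableSet {z : α × α | z.1 ≠ z.2} :=
    (measurableSet_eq_fun measurable_fst measurable_snd).compl
  have hdiag : Measurable fun x : α => (x, x) := measurable_id.prodMk measurable_id
  refine ⟨ν.map (fun x => (x, x)) + e⁻¹ • ρ₁.prod ρ₂, ?_, ?_, fun B hB => ⟨?_, ?_⟩⟩
  · rw [Measure.map_add _ _ measurable_fst, Measure.map_map measurable_fst hdiag,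
      Measure.map_smul, Measure.map_fst_prod, he₂, inv_smul_smul_measure_univ ρ₁ he.symm hefin]
    simpa [Function.comp_def] using hfe
  · rw [Measure.map_add _ _ measurable_snd, Measure.map_map measurable_snd hdiag,
      Measure.map_smul, Measure.map_snd_prod, ← he, inv_smul_smul_measure_univ ρ₂ he₂ hefin]
    simpa [Function.comp_def] using hge
  · have h0 : ν.map (fun x => (x, x)) ({z | z.1 ≠ z.2} ∩ Prod.fst ⁻¹' B) = 0 := by
      rw [Measure.map_apply hdiag (hoff.inter (measurable_fst hB))]
      simp
    rw [Measure.add_apply, h0, zero_add, ← withDensity_apply _ hB, ← hρ₁]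
    calc _ ≤ (e⁻¹ • ρ₁.prod ρ₂) (Prod.fst ⁻¹' B) := measure_mono Set.inter_subset_right
      _ = (e⁻¹ • ρ₁.prod ρ₂).map Prod.fst B := (Measure.map_apply measurable_fst hB).symm
      _ = ρ₁ B := by
        rw [Measure.map_smul, Measure.map_fst_prod, he₂,
          inv_smul_smul_measure_univ ρ₁ he.symm hefin]
  · have h0 : ν.map (fun x => (x, x)) ({z | z.1 ≠ z.2} ∩ Prod.snd ⁻¹' B) = 0 := by
      rw [Measure.map_apply hdiag (hoff.inter (measurable_snd hB))]
      simp
    rw [Measure.add_apply, h0, zero_add, ← withDensity_apply _ hB, ← hρ₂]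
    calc _ ≤ (e⁻¹ • ρ₁.prod ρ₂) (Prod.snd ⁻¹' B) := measure_mono Set.inter_subset_right
      _ = (e⁻¹ • ρ₁.prod ρ₂).map Prod.snd B := (Measure.map_apply measurable_snd hB).symm
      _ = ρ₂ B := by
        rw [Measure.map_smul, Measure.map_snd_prod, ← he,
          inv_smul_smul_measure_univ ρ₂ he₂ hefin]

end Coupling

/-! ### Hölder's inequality over pairs of nearby points -/

section NearPairs

lemma lintegral_near_pairs {d : ℕ} (r : ℝ) {F : Pt d × Pt d → ℝ≥0∞} (hF : Measurable F) :
    ∫⁻ q, F q ∂((volume.prod volume).restrict {q : Pt d × Pt d | dist q.2 q.1 ≤ r}) =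
      ∫⁻ x, ∫⁻ y in Metric.closedBall x r, F (x, y) := by
  have hs : MeasurableSet {q : Pt d × Pt d | dist q.2 q.1 ≤ r} :=
    measurableSet_le (by fun_prop) (by fun_prop)
  rw [← lintegral_indicator hs, lintegral_prod _ (hF.indicator hs).aemeasurable]
  refine lintegral_congr fun x => ?_
  rw [← lintegral_indicator Metric.isClosed_closedBall.measurableSet]
  rfl

lemma volume_closedBall_eq_center_zero {d : ℕ} (x : Pt d) (r : ℝ) :
    volume (Metric.closedBall x r) = volume (Metric.closedBall (0 : Pt d) r) :=
  Measure.addHaar_closedBall_center volume x r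

lemma lintegral_near_pairs_fst {d : ℕ} (r : ℝ) {u : Pt d → ℝ≥0∞} (hu : Measurable u) :
    ∫⁻ q, u q.1 ∂((volume.prod volume).restrict {q : Pt d × Pt d | dist q.2 q.1 ≤ r}) =
      volume (Metric.closedBall (0 : Pt d) r) * ∫⁻ x, u x := by
  rw [lintegral_near_pairs r (F := fun q => u q.1) (by fun_prop)]
  simp only [lintegral_const, Measure.restrict_apply_univ, volume_closedBall_eq_center_zero]
  rw [lintegral_mul_const _ hu, mul_comm]

lemma lintegral_near_pairs_snd {d : ℕ} (r : ℝ) {u : Pt d → ℝ≥0∞} (hu : Measurable u) :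
    ∫⁻ q, u q.2 ∂((volume.prod volume).restrict {q : Pt d × Pt d | dist q.2 q.1 ≤ r}) =
      volume (Metric.closedBall (0 : Pt d) r) * ∫⁻ x, u x := by
  have hs : MeasurableSet {q : Pt d × Pt d | dist q.2 q.1 ≤ r} :=
    measurableSet_le (by fun_prop) (by fun_prop)
  rw [← lintegral_near_pairs_fst r hu, ← lintegral_indicator hs, ← lintegral_indicator hs,
    ← lintegral_prod_swap]
  refine lintegral_congr fun q => ?_
  simp [Set.indicator_apply, dist_comm]

/-- Hölder's inequality on the set of pairs at distance at most `r`, with the exponents `1 / p`,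
`1 / (p (p - 1))` and `(p - 2) / (p - 1)` for `u ^ p`, `w ^ p` and `w`; each of these functions
depends on one point only, so that its integral over the pairs carries the volume of a ball. -/
theorem lintegral_near_pairs_le {d : ℕ} {p : ℝ} (hp : 2 < p) (r : ℝ) {u w : Pt d → ℝ≥0∞}
    (hu : Measurable u) (hw : Measurable w) :
    ∫⁻ x, ∫⁻ y in Metric.closedBall x r, u x * w y ≤
      volume (Metric.closedBall (0 : Pt d) r) * ((∫⁻ x, u x ^ p) ^ (1 / p) *
        ((∫⁻ x, w x ^ p) ^ (1 / (p * (p - 1))) * (∫⁻ x, w x) ^ ((p - 2) / (p - 1)))) := by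
  set V := volume (Metric.closedBall (0 : Pt d) r)
  have hp1 : 0 < p - 1 := by linarith
  have hp0 : 0 < p := by linarith
  have ha : 0 ≤ 1 / p := by positivity
  have hb : 0 ≤ 1 / (p * (p - 1)) := by positivity
  have hc : 0 ≤ (p - 2) / (p - 1) := div_nonneg (by linarith) hp1.le
  have hsum : 1 / p + (1 / (p * (p - 1)) + (p - 2) / (p - 1)) = 1 := by
    field_simp
    ring
  have hpt (q : Pt d × Pt d) : u q.1 * w q.2 =
      (u q.1 ^ p) ^ (1 / p) * ((w q.2 ^ p) ^ (1 / (p * (p - 1))) * w q.2 ^ ((p - 2) / (p - 1))) := by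
    rw [← ENNReal.rpow_mul, ← ENNReal.rpow_mul, ← ENNReal.rpow_add_of_nonneg _ _ (by positivity) hc]
    have e1 : p * (1 / p) = 1 := by field_simp
    have e2 : p * (1 / (p * (p - 1))) + (p - 2) / (p - 1) = 1 := by
      field_simp
      ring
    rw [e1, e2, ENNReal.rpow_one, ENNReal.rpow_one]
  rw [← lintegral_near_pairs r (F := fun q => u q.1 * w q.2) (by fun_prop)]
  simp_rw [hpt]
  have hH := ENNReal.lintegral_prod_norm_pow_le
    (μ := (volume.prod volume).restrict {q : Pt d × Pt d | dist q.2 q.1 ≤ r}) Finset.univ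
    (f := ![fun q => u q.1 ^ p, fun q => w q.2 ^ p, fun q => w q.2])
    (p := ![1 / p, 1 / (p * (p - 1)), (p - 2) / (p - 1)])
    (fun i _ => by fin_cases i <;> exact Measurable.aemeasurable (by dsimp; fun_prop))
    (by simpa [Fin.sum_univ_three, add_assoc] using hsum)
    (fun i _ => by fin_cases i; exacts [ha, hb, hc])
  simp only [Fin.prod_univ_three, Matrix.cons_val_zero, Matrix.cons_val_one, Matrix.cons_val,
    mul_assoc] at hH
  refine hH.trans (le_of_eq ?_)
  rw [lintegral_near_pairs_fst r (u := fun x => u x ^ p) (by fun_prop),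
    lintegral_near_pairs_snd r (u := fun x => w x ^ p) (by fun_prop),
    lintegral_near_pairs_snd r hw, ENNReal.mul_rpow_of_nonneg _ _ ha,
    ENNReal.mul_rpow_of_nonneg _ _ hb, ENNReal.mul_rpow_of_nonneg _ _ hc]
  have hV : V = V ^ (1 / p) * (V ^ (1 / (p * (p - 1))) * V ^ ((p - 2) / (p - 1))) := by
    rw [← ENNReal.rpow_add_of_nonneg _ _ hb hc,
      ← ENNReal.rpow_add_of_nonneg _ _ ha (add_nonneg hb hc), hsum, ENNReal.rpow_one]
  conv_rhs => rw [hV]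
  ring

end NearPairs

/-! ### Point clouds and add-one costs -/

section PointClouds

/-- Measurability into the finite multisets can be tested on the counting maps. -/
lemma measurable_multiset_of_count {α β : Type*} [MeasurableSpace α] [MeasurableSpace β]
    {φ : β → Multiset α}
    (h : ∀ B : Set α, MeasurableSet B →
      Measurable fun b => (Multiset.map (B.indicator fun _ => (1 : ℕ)) (φ b)).sum) :
    Measurable φ := by
  rw [measurable_iff_le_map]
  refine iSup_le fun B => ?_
  rw [MeasurableSpace.comap_le_iff_le_map]
  exact measurable_iff_le_map.1 (h B B.2)

lemma measurable_rescale_toMultiset {d : ℕ} (m n : ℕ) :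
    Measurable fun x : Fin n → Pt d => rescale m (toMultiset x) := by
  refine measurable_multiset_of_count fun B hB => ?_
  have hind : Measurable (B.indicator fun _ => (1 : ℕ)) := measurable_const.indicator hB
  simp only [rescale, toMultiset, Multiset.map_map, Function.comp_def]
  exact Finset.measurable_sum (f := fun i (x : Fin n → Pt d) => B.indicator (fun _ => (1 : ℕ))
    (((m : ℝ) ^ (1 / (d : ℝ))) • x i)) Finset.univ fun i _ => hind.comp (by fun_prop)

lemma measurable_rescale_cons_toMultiset {d : ℕ} (m n : ℕ) :
    Measurable fun q : (Fin n → Pt d) × Pt d => rescale m (q.2 ::ₘ toMultiset q.1) := by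
  refine measurable_multiset_of_count fun B hB => ?_
  have hind : Measurable (B.indicator fun _ => (1 : ℕ)) := measurable_const.indicator hB
  simp only [rescale, toMultiset, Multiset.map_map, Function.comp_def, Multiset.map_cons,
    Multiset.sum_cons]
  refine Measurable.add (hind.comp (by fun_prop)) ?_
  exact Finset.measurable_sum (f := fun i (q : (Fin n → Pt d) × Pt d) =>
    B.indicator (fun _ => (1 : ℕ)) (((m : ℝ) ^ (1 / (d : ℝ))) • q.1 i)) Finset.univ
      fun i _ => hind.comp (by fun_prop)

lemma cons_toMultiset_update {α : Type*} {n : ℕ} (z : Fin n → α) (i : Fin n) (w : α) :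
    z i ::ₘ toMultiset (Function.update z i w) = w ::ₘ toMultiset z := by
  have hu : (Finset.univ : Finset (Fin n)).val = i ::ₘ (Finset.univ.erase i).val := by
    rw [Finset.erase_val, Multiset.cons_erase (Finset.mem_univ i)]
  have hc : Multiset.map (Function.update z i w) (Finset.univ.erase i).val =
      Multiset.map z (Finset.univ.erase i).val := by
    refine Multiset.map_congr rfl fun j hj => ?_
    rw [Finset.mem_val] at hj
    exact Function.update_of_ne (Finset.ne_of_mem_erase hj) _ _
  rw [toMultiset, toMultiset, hu, Multiset.map_cons, Multiset.map_cons, hc, Function.update_self,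
    Multiset.cons_swap]

lemma restrictBall_rescale_congr {d n : ℕ} (m : ℕ) {x y : Fin n → Pt d} {z : Pt d} {r : ℝ}
    (h : ∀ i, x i = y i ∨
      ((m : ℝ) ^ (1 / (d : ℝ))) • x i ∉ Metric.closedBall z r ∧
      ((m : ℝ) ^ (1 / (d : ℝ))) • y i ∉ Metric.closedBall z r) :
    restrictBall (rescale m (toMultiset x)) z r = restrictBall (rescale m (toMultiset y)) z r := by
  classical
  simp only [restrictBall, rescale, toMultiset, Multiset.map_map, Multiset.filter_map]
  have hf : Multiset.filter ((fun x => x ∈ Metric.closedBall z r) ∘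
        ((fun x => ((m : ℝ) ^ (1 / (d : ℝ))) • x) ∘ x)) (Finset.univ : Finset (Fin n)).val =
      Multiset.filter ((fun x => x ∈ Metric.closedBall z r) ∘
        ((fun x => ((m : ℝ) ^ (1 / (d : ℝ))) • x) ∘ y)) (Finset.univ : Finset (Fin n)).val := by
    refine Multiset.filter_congr fun i _ => ?_
    rcases h i with h | h
    · simp [h]
    · simp only [Function.comp_apply]
      exact iff_of_false h.1 h.2
  rw [hf]
  refine Multiset.map_congr rfl fun i hi => ?_
  rcases h i with h | h
  · simp [h]
  · exact absurd (Multiset.mem_filter.1 hi).2 h.2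

/-- The add-one cost at `n^{1/d} y'` of the rescaled sample `n^{1/d} y`. -/
noncomputable def sampleAddOneCost {d : ℕ} (ψ : Multiset (Pt d) → ℝ) (n : ℕ)
    (q : (Fin n → Pt d) × Pt d) : ℝ :=
  ψ (rescale n (q.2 ::ₘ toMultiset q.1)) - ψ (rescale n (toMultiset q.1))

lemma measurable_sampleAddOneCost {d : ℕ} {ψ : Multiset (Pt d) → ℝ} (hψ : Measurable ψ) (n : ℕ) :
    Measurable (sampleAddOneCost ψ n) :=
  (hψ.comp (measurable_rescale_cons_toMultiset n n)).sub
    (hψ.comp ((measurable_rescale_toMultiset n n).comp measurable_fst))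

lemma sampleAddOneCost_eq {d : ℕ} (ψ : Multiset (Pt d) → ℝ) (n : ℕ) (q : (Fin n → Pt d) × Pt d) :
    sampleAddOneCost ψ n q =
      addOneCost ψ (((n : ℝ) ^ (1 / (d : ℝ))) • q.2) (rescale n (toMultiset q.1)) := by
  simp [sampleAddOneCost, addOneCost, rescale]

/-- Resampling a point changes the statistic by a difference of two add-one costs: insert the new
point, then delete the old one. -/
lemma stat_sub_stat_update {d : ℕ} (ψ : Multiset (Pt d) → ℝ) {n : ℕ} (z : Fin n → Pt d)
    (i : Fin n) (w : Pt d) :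
    ψ (rescale n (toMultiset z)) - ψ (rescale n (toMultiset (Function.update z i w))) =
      sampleAddOneCost ψ n (Function.update z i w, z i) - sampleAddOneCost ψ n (z, w) := by
  simp only [sampleAddOneCost, cons_toMultiset_update]
  ring

end PointClouds

/-! ### Second moments of differences supported on a small event -/

section Holder

/-- Two variables with `a`-th moments bounded by `E`, `a > 2`, that agree off `s` are close in `L²`
when `s` is small. The set `s` need not be measurable. -/
lemma lintegral_sq_sub_le_of_eq_off {α : Type*} [MeasurableSpace α] {μ : Measure α} {a : ℝ}
    (ha : 2 < a) {U V : α → ℝ} (hU : Measurable U) (hV : Measurable V) {E : ℝ≥0∞}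
    (hUE : ∫⁻ q, ENNReal.ofReal (|U q| ^ a) ∂μ ≤ E) (hVE : ∫⁻ q, ENNReal.ofReal (|V q| ^ a) ∂μ ≤ E)
    {s : Set α} (hs : ∀ q, q ∉ s → U q = V q) :
    ∫⁻ q, ENNReal.ofReal ((U q - V q) ^ 2) ∂μ ≤
      (2 ^ (a - 1) * (E + E)) ^ (2 / a) * μ s ^ (1 - 2 / a) := by
  have ha0 : 0 < a := by linarith
  have h1 : 0 ≤ 2 / a := by positivity
  have h2 : 0 ≤ 1 - 2 / a := by
    rw [sub_nonneg, div_le_one ha0]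
    exact ha.le
  have h2' : 0 < 1 - 2 / a := by
    rw [sub_pos, div_lt_one ha0]
    exact ha
  have hmom : ∫⁻ q, ENNReal.ofReal (|U q - V q| ^ a) ∂μ ≤ 2 ^ (a - 1) * (E + E) := by
    calc ∫⁻ q, ENNReal.ofReal (|U q - V q| ^ a) ∂μ
        ≤ ∫⁻ q, 2 ^ (a - 1) * (ENNReal.ofReal (|U q| ^ a) + ENNReal.ofReal (|V q| ^ a)) ∂μ := by
          refine lintegral_mono fun q => ?_
          simp only [← ENNReal.ofReal_rpow_of_nonneg (abs_nonneg _) ha0.le]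
          refine le_trans ?_ (ENNReal.rpow_add_le_mul_rpow_add_rpow _ _ (by linarith))
          rw [← ENNReal.ofReal_add (abs_nonneg _) (abs_nonneg _)]
          gcongr
          exact abs_sub _ _
      _ ≤ 2 ^ (a - 1) * (E + E) := by
          rw [lintegral_const_mul _ (by fun_prop), lintegral_add_left (by fun_prop)]
          gcongr
  -- `s` may fail to be measurable, its measurable hull has the same measure
  set t := toMeasurable μ s
  have ht : MeasurableSet t := measurableSet_toMeasurable μ s
  calc ∫⁻ q, ENNReal.ofReal ((U q - V q) ^ 2) ∂μ
      ≤ ∫⁻ q, ENNReal.ofReal (|U q - V q| ^ a) ^ (2 / a) *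
          (t.indicator (fun _ => (1 : ℝ≥0∞)) q) ^ (1 - 2 / a) ∂μ := by
        refine lintegral_mono fun q => ?_
        by_cases hq : q ∈ t
        · simp only [Set.indicator_of_mem hq, ENNReal.one_rpow, mul_one]
          rw [ENNReal.ofReal_rpow_of_nonneg (by positivity) h1, ← Real.rpow_mul (abs_nonneg _),
            mul_div_cancel₀ _ ha0.ne', ← sq_abs]
          norm_num
        · have : U q = V q := hs q fun h => hq (subset_toMeasurable μ s h)
          simp [this]
    _ ≤ (∫⁻ q, ENNReal.ofReal (|U q - V q| ^ a) ∂μ) ^ (2 / a) *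
          (∫⁻ q, t.indicator (fun _ => (1 : ℝ≥0∞)) q ∂μ) ^ (1 - 2 / a) :=
        ENNReal.lintegral_mul_norm_pow_le (Measurable.aemeasurable (by fun_prop))
          (measurable_const.indicator ht).aemeasurable h1 h2 (by ring)
    _ ≤ _ := by
        rw [lintegral_indicator_const ht, one_mul, measure_toMeasurable]
        gcongr

end Holder

/-! ### Couplings of two densities -/

section DensityCoupling

/-- `π` is a coupling of the laws with densities `f` and `g` under which the two coordinates
differ while one of them lies in `B` with probability at most `∫_B |f - g|`. -/
structure IsDensityCoupling {d : ℕ} (f g : Pt d → ℝ) (π : Measure (Pt d × Pt d)) : Prop where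
  map_fst : π.map Prod.fst = densityMeasure f
  map_snd : π.map Prod.snd = densityMeasure g
  measure_ne_inter_le : ∀ B : Set (Pt d), MeasurableSet B →
    π ({z | z.1 ≠ z.2} ∩ (Prod.fst ⁻¹' B ∪ Prod.snd ⁻¹' B)) ≤
      ∫⁻ x in B, ENNReal.ofReal |f x - g x|

lemma exists_isDensityCoupling {d : ℕ} {f g : Pt d → ℝ} (hf : IsProbDensity f)
    (hg : IsProbDensity g) : ∃ π, IsDensityCoupling f g π := by
  have := hf.isProb
  have := hg.isProb
  have hfm := hf.measurable
  have hgm := hg.measurable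
  unfold densityMeasure at *
  obtain ⟨π, h1, h2, h3⟩ := exists_maximal_coupling (volume : Measure (Pt d))
    (f := fun x => ENNReal.ofReal (f x)) (g := fun x => ENNReal.ofReal (g x))
    (by fun_prop) (by fun_prop)
  refine ⟨π, h1, h2, fun B hB => ?_⟩
  rw [Set.inter_union_distrib_left]
  refine (measure_union_le _ _).trans ((add_le_add (h3 B hB).1 (h3 B hB).2).trans (le_of_eq ?_))
  rw [← lintegral_add_left (by fun_prop)]
  refine lintegral_congr fun x => ?_
  rw [← ENNReal.ofReal_sub _ (hg.nonneg x), ← ENNReal.ofReal_sub _ (hf.nonneg x)]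
  rcases le_total (f x) (g x) with h | h
  · rw [ENNReal.ofReal_of_nonpos (sub_nonpos.2 h), zero_add, abs_of_nonpos (sub_nonpos.2 h),
      neg_sub]
  · rw [ENNReal.ofReal_of_nonpos (sub_nonpos.2 h), add_zero, abs_of_nonneg (sub_nonneg.2 h)]

variable {d : ℕ} {f g : Pt d → ℝ} {π : Measure (Pt d × Pt d)}

lemma IsDensityCoupling.isProbabilityMeasure (hπ : IsDensityCoupling f g π)
    (hf : IsProbDensity f) : IsProbabilityMeasure π := by
  have h := hf.isProb
  rw [← hπ.map_fst] at h
  exact ⟨by simpa [Measure.map_apply measurable_fst] using h.measure_univ⟩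

lemma IsDensityCoupling.measurePreserving_pi_fst [IsProbabilityMeasure π]
    (hπ : IsDensityCoupling f g π) (hf : IsProbDensity f) (n : ℕ) :
    MeasurePreserving (fun (z : Fin n → Pt d × Pt d) i => (z i).1) (Measure.pi fun _ => π)
      (Measure.pi fun _ => densityMeasure f) := by
  have := hf.isProb
  exact measurePreserving_pi _ _ fun _ => ⟨measurable_fst, hπ.map_fst⟩

lemma IsDensityCoupling.measurePreserving_pi_snd [IsProbabilityMeasure π]
    (hπ : IsDensityCoupling f g π) (hg : IsProbDensity g) (n : ℕ) :
    MeasurePreserving (fun (z : Fin n → Pt d × Pt d) i => (z i).2) (Measure.pi fun _ => π)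
      (Measure.pi fun _ => densityMeasure g) := by
  have := hg.isProb
  exact measurePreserving_pi _ _ fun _ => ⟨measurable_snd, hπ.map_snd⟩

lemma IsDensityCoupling.measurePreserving_sample_fst [IsProbabilityMeasure π]
    (hπ : IsDensityCoupling f g π) (hf : IsProbDensity f) (n : ℕ) :
    MeasurePreserving (fun q : (Fin n → Pt d × Pt d) × (Pt d × Pt d) =>
        ((fun i => (q.1 i).1, q.2.1) : (Fin n → Pt d) × Pt d))
      ((Measure.pi fun _ => π).prod π) (sampleWithCopy (densityMeasure f) n) := by
  have := hf.isProb
  exact (hπ.measurePreserving_pi_fst hf n).prod ⟨measurable_fst, hπ.map_fst⟩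

lemma IsDensityCoupling.measurePreserving_sample_snd [IsProbabilityMeasure π]
    (hπ : IsDensityCoupling f g π) (hg : IsProbDensity g) (n : ℕ) :
    MeasurePreserving (fun q : (Fin n → Pt d × Pt d) × (Pt d × Pt d) =>
        ((fun i => (q.1 i).2, q.2.2) : (Fin n → Pt d) × Pt d))
      ((Measure.pi fun _ => π).prod π) (sampleWithCopy (densityMeasure g) n) := by
  have := hg.isProb
  exact (hπ.measurePreserving_pi_snd hg n).prod ⟨measurable_snd, hπ.map_snd⟩

lemma IsDensityCoupling.measure_ne_le (hπ : IsDensityCoupling f g π) :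
    π {z | z.1 ≠ z.2} ≤ ∫⁻ x, ENNReal.ofReal |f x - g x| := by
  simpa using hπ.measure_ne_inter_le Set.univ MeasurableSet.univ

lemma IsDensityCoupling.measure_ne_near_le [IsProbabilityMeasure π]
    (hπ : IsDensityCoupling f g π) (hf : IsProbDensity f) (hg : IsProbDensity g) (r : ℝ) :
    (π.prod π) {q | q.1.1 ≠ q.1.2 ∧ (dist q.1.1 q.2.1 ≤ r ∨ dist q.1.2 q.2.1 ≤ r)} ≤
      ∫⁻ x, ∫⁻ y in Metric.closedBall x r, ENNReal.ofReal (f x) * ENNReal.ofReal |f y - g y| := by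
  have hfm := hf.measurable
  have hgm := hg.measurable
  have hs : MeasurableSet {q : (Pt d × Pt d) × (Pt d × Pt d) |
      q.1.1 ≠ q.1.2 ∧ (dist q.1.1 q.2.1 ≤ r ∨ dist q.1.2 q.2.1 ≤ r)} := by
    refine (measurableSet_eq_fun measurable_fst.fst measurable_fst.snd).compl.inter
      (MeasurableSet.union ?_ ?_)
    · exact measurableSet_le (measurable_fst.fst.dist measurable_snd.fst) measurable_const
    · exact measurableSet_le (measurable_fst.snd.dist measurable_snd.fst) measurable_const
  have hκ : Measurable fun x : Pt d =>
      ∫⁻ y in Metric.closedBall x r, ENNReal.ofReal |f y - g y| := by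
    have hms : MeasurableSet {q : Pt d × Pt d | dist q.2 q.1 ≤ r} :=
      measurableSet_le (by fun_prop) (by fun_prop)
    have := Measurable.lintegral_prod_right' (ν := (volume : Measure (Pt d)))
      (f := {q : Pt d × Pt d | dist q.2 q.1 ≤ r}.indicator
        fun q => ENNReal.ofReal |f q.2 - g q.2|) (Measurable.indicator (by fun_prop) hms)
    convert this using 2 with x
    rw [← lintegral_indicator Metric.isClosed_closedBall.measurableSet]
    rfl
  rw [Measure.prod_apply_symm hs]
  calc _ ≤ ∫⁻ z, (∫⁻ y in Metric.closedBall z.1 r, ENNReal.ofReal |f y - g y|) ∂π := by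
        refine lintegral_mono fun z => ?_
        exact hπ.measure_ne_inter_le (Metric.closedBall z.1 r)
          Metric.isClosed_closedBall.measurableSet
    _ = ∫⁻ x, (∫⁻ y in Metric.closedBall x r, ENNReal.ofReal |f y - g y|) ∂(densityMeasure f) := by
        rw [← hπ.map_fst, lintegral_map hκ measurable_fst]
    _ = _ := by
        rw [densityMeasure, lintegral_withDensity_eq_lintegral_mul _ (by fun_prop) hκ]
        refine lintegral_congr fun x => ?_
        rw [Pi.mul_apply, lintegral_const_mul _ (by fun_prop)]

lemma dist_rpow_smul_le_iff {n : ℕ} (hn : 1 ≤ n) (x y : Pt d) (l : ℝ) :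
    dist (((n : ℝ) ^ (1 / (d : ℝ))) • x) (((n : ℝ) ^ (1 / (d : ℝ))) • y) ≤ l ↔
      dist x y ≤ l / (n : ℝ) ^ (1 / (d : ℝ)) := by
  have : 0 < (n : ℝ) ^ (1 / (d : ℝ)) := Real.rpow_pos_of_pos (by exact_mod_cast hn) _
  rw [dist_smul₀, Real.norm_of_nonneg this.le, le_div_iff₀ this, mul_comm]

/-- The scaling `n^{1/d}` makes `n` balls of scaled radius `l` have a total volume free of `n`. -/
lemma natCast_mul_volume_closedBall (hd : 1 ≤ d) {n : ℕ} (hn : 1 ≤ n) (l : ℝ) :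
    n * volume (Metric.closedBall (0 : Pt d) (l / (n : ℝ) ^ (1 / (d : ℝ)))) =
      ENNReal.ofReal l ^ d * volume (Metric.closedBall (0 : Pt d) 1) := by
  have : Nonempty (Fin d) := ⟨⟨0, hd⟩⟩
  have hn0 : (0 : ℝ) < n := by exact_mod_cast hn
  have hs : 0 < (n : ℝ) ^ (1 / (d : ℝ)) := Real.rpow_pos_of_pos hn0 _
  have hsd : ((n : ℝ) ^ (1 / (d : ℝ))) ^ d = n := by
    rw [← Real.rpow_natCast, ← Real.rpow_mul hn0.le, one_div_mul_cancel, Real.rpow_one]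
    exact_mod_cast (Nat.pos_of_ne_zero (by omega)).ne'
  rw [EuclideanSpace.volume_closedBall, EuclideanSpace.volume_closedBall, Fintype.card_fin,
    ENNReal.ofReal_one, one_pow, one_mul, ← mul_assoc]
  congr 1
  rw [ENNReal.ofReal_div_of_pos hs, ENNReal.div_eq_inv_mul, mul_pow, ← ENNReal.inv_pow,
    ← ENNReal.ofReal_pow hs.le, hsd, ENNReal.ofReal_natCast, ← mul_assoc,
    ENNReal.mul_inv_cancel (by exact_mod_cast hn0.ne') (ENNReal.natCast_ne_top n), one_mul]

end DensityCoupling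

/-! ### The variance of the difference of two coupled statistics -/

section VarianceModulus

variable {d : ℕ}

/-- The samples at which restriction to the ball of radius `l` changes the add-one cost. -/
def unstableSet (ψ : Multiset (Pt d) → ℝ) (n : ℕ) (l : ℝ) : Set ((Fin n → Pt d) × Pt d) :=
  {y | addOneCost ψ (((n : ℝ) ^ (1 / (d : ℝ))) • y.2)
      (restrictBall (rescale n (toMultiset y.1)) (((n : ℝ) ^ (1 / (d : ℝ))) • y.2) l)
    ≠ addOneCost ψ (((n : ℝ) ^ (1 / (d : ℝ))) • y.2) (rescale n (toMultiset y.1))}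

/-- The pairs of coupled points that differ and of which one comes within distance `r` of the
first component of a second pair. -/
def nearDisagreement (d : ℕ) (r : ℝ) : Set ((Pt d × Pt d) × (Pt d × Pt d)) :=
  {q | q.1.1 ≠ q.1.2 ∧ (dist q.1.1 q.2.1 ≤ r ∨ dist q.1.2 q.2.1 ≤ r)}

/-- The event outside which the add-one costs of two coupled samples agree. -/
def disagreementSet (ψ : Multiset (Pt d) → ℝ) (n : ℕ) (l : ℝ) :
    Set ((Fin n → Pt d × Pt d) × (Pt d × Pt d)) :=
  {q | q.2.1 ≠ q.2.2} ∪
    ((fun q => ((fun i => (q.1 i).1, q.2.1) : (Fin n → Pt d) × Pt d)) ⁻¹' unstableSet ψ n l ∪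
      (fun q => ((fun i => (q.1 i).2, q.2.2) : (Fin n → Pt d) × Pt d)) ⁻¹' unstableSet ψ n l) ∪
    ⋃ i, (fun q => (q.1 i, q.2)) ⁻¹' nearDisagreement d (l / (n : ℝ) ^ (1 / (d : ℝ)))

lemma sampleAddOneCost_eq_of_notMem_disagreementSet {ψ : Multiset (Pt d) → ℝ} {n : ℕ} (hn : 1 ≤ n)
    {l : ℝ} {q : (Fin n → Pt d × Pt d) × (Pt d × Pt d)} (hq : q ∉ disagreementSet ψ n l) :
    sampleAddOneCost ψ n (fun i => (q.1 i).1, q.2.1) =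
      sampleAddOneCost ψ n (fun i => (q.1 i).2, q.2.2) := by
  simp only [disagreementSet, Set.mem_union, not_or, Set.mem_iUnion, not_exists, Set.mem_preimage,
    Set.mem_ofPred_eq, unstableSet, not_not, nearDisagreement, not_and] at hq
  obtain ⟨⟨h1, h2, h3⟩, h4⟩ := hq
  rw [sampleAddOneCost_eq, sampleAddOneCost_eq, ← h2, ← h3, ← h1]
  congr 1
  refine restrictBall_rescale_congr n fun i => ?_
  by_cases h : (q.1 i).1 = (q.1 i).2
  · exact Or.inl h
  · right
    rw [Metric.mem_closedBall, Metric.mem_closedBall, dist_rpow_smul_le_iff hn,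
      dist_rpow_smul_le_iff hn]
    exact h4 i h

lemma densityMeasure_mem_tvClosedBall {f g : Pt d → ℝ} (hf : IsProbDensity f)
    (hg : IsProbDensity g) {ε : ℝ} (hε : 0 ≤ ε)
    (h : ∫⁻ x, ENNReal.ofReal |f x - g x| ≤ ENNReal.ofReal ε) :
    densityMeasure g ∈ tvClosedBall (densityMeasure f) ε := by
  have key {u v : Pt d → ℝ} (hu : IsProbDensity u) (hv : IsProbDensity v)
      (h : ∫⁻ x, ENNReal.ofReal |u x - v x| ≤ ENNReal.ofReal ε) {A : Set (Pt d)}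
      (hA : MeasurableSet A) : (densityMeasure u).real A ≤ (densityMeasure v).real A + ε := by
    have := hu.isProb
    have := hv.isProb
    have hum := hu.measurable
    have hvm := hv.measurable
    have h1 : densityMeasure u A ≤ densityMeasure v A + ENNReal.ofReal ε := by
      rw [densityMeasure, densityMeasure, withDensity_apply _ hA, withDensity_apply _ hA]
      refine le_trans ?_ (add_le_add_right ((setLIntegral_le_lintegral A _).trans h) _)
      rw [← lintegral_add_left (by fun_prop)]
      refine lintegral_mono fun x => ?_
      rw [← ENNReal.ofReal_add (hv.nonneg x) (abs_nonneg _)]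
      exact ENNReal.ofReal_le_ofReal (by linarith [le_abs_self (u x - v x)])
    have h2 := ENNReal.toReal_mono
      (ENNReal.add_ne_top.2 ⟨measure_ne_top _ _, ENNReal.ofReal_ne_top⟩) h1
    rwa [ENNReal.toReal_add (measure_ne_top _ _) ENNReal.ofReal_ne_top,
      ENNReal.toReal_ofReal hε] at h2
  intro A hA
  have h1 := key hf hg h hA
  have h2 := key hg hf (by simpa only [abs_sub_comm] using h) hA
  rw [abs_le]
  constructor <;> linarith

lemma lintegral_near_density_le {f g : Pt d → ℝ} (hf : IsProbDensity f)
    (hg : IsProbDensity g) {p M ε : ℝ} (hp : 2 < p)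
    (hfM : eLpNorm f (ENNReal.ofReal p) volume ≤ ENNReal.ofReal M)
    (hgM : eLpNorm g (ENNReal.ofReal p) volume ≤ ENNReal.ofReal M)
    (h : ∫⁻ x, ENNReal.ofReal |f x - g x| ≤ ENNReal.ofReal ε) (r : ℝ) :
    ∫⁻ x, ∫⁻ y in Metric.closedBall x r, ENNReal.ofReal (f x) * ENNReal.ofReal |f y - g y| ≤
      volume (Metric.closedBall (0 : Pt d) r) * (ENNReal.ofReal M *
        ((2 * ENNReal.ofReal M) ^ (1 / (p - 1)) * ENNReal.ofReal ε ^ ((p - 2) / (p - 1)))) := by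
  have hfm := hf.measurable
  have hgm := hg.measurable
  have hp0 : 0 < p := by linarith
  have hp1 : 0 < p - 1 := by linarith
  have hp2 : 0 < p - 2 := by linarith
  have hpne : ENNReal.ofReal p ≠ 0 := by simpa using hp0
  have e1 : (∫⁻ x, ENNReal.ofReal (f x) ^ p) ^ (1 / p) ≤ ENNReal.ofReal M := by
    refine le_trans (le_of_eq ?_) hfM
    rw [eLpNorm_eq_lintegral_rpow_enorm_toReal hpne ENNReal.ofReal_ne_top,
      ENNReal.toReal_ofReal hp0.le]
    simp_rw [Real.enorm_of_nonneg (hf.nonneg _)]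
  have e2 : (∫⁻ x, ENNReal.ofReal |f x - g x| ^ p) ^ (1 / p) ≤ 2 * ENNReal.ofReal M := by
    rw [two_mul]
    refine le_trans (le_of_eq ?_) ((eLpNorm_sub_le (p := ENNReal.ofReal p)
      hfm.aestronglyMeasurable hgm.aestronglyMeasurable
      (ENNReal.one_le_ofReal.2 (by linarith))).trans (add_le_add hfM hgM))
    rw [eLpNorm_eq_lintegral_rpow_enorm_toReal hpne ENNReal.ofReal_ne_top,
      ENNReal.toReal_ofReal hp0.le]
    simp_rw [Pi.sub_apply, Real.enorm_eq_ofReal_abs]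
  refine (lintegral_near_pairs_le hp r (by fun_prop) (by fun_prop)).trans ?_
  have e3 : (1 : ℝ) / (p * (p - 1)) = 1 / p * (1 / (p - 1)) := by field_simp
  rw [e3, ENNReal.rpow_mul]
  gcongr

/-- The bound is uniform in `n`: the `n` sample points contribute `n` times the volume of a ball of
radius `l n^{-1/d}`, and the exponent of `ε` left over by Hölder's inequality is `d` times the
exponent `(p - 2) / (d (p - 1))` of the stabilization condition. -/
lemma measure_disagreementSet_le (hd : 1 ≤ d) {f g : Pt d → ℝ} (hf : IsProbDensity f)
    (hg : IsProbDensity g) {p M ε : ℝ} (hp : 2 < p) (hε : 0 < ε)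
    (hfM : eLpNorm f (ENNReal.ofReal p) volume ≤ ENNReal.ofReal M)
    (hgM : eLpNorm g (ENNReal.ofReal p) volume ≤ ENNReal.ofReal M)
    (h : ∫⁻ x, ENNReal.ofReal |f x - g x| ≤ ENNReal.ofReal ε)
    {π : Measure (Pt d × Pt d)} [IsProbabilityMeasure π] (hπ : IsDensityCoupling f g π)
    (ψ : Multiset (Pt d) → ℝ) {n : ℕ} (hn : 1 ≤ n) (l : ℝ) {s : ℝ≥0∞}
    (hsf : sampleWithCopy (densityMeasure f) n (unstableSet ψ n l) ≤ s)
    (hsg : sampleWithCopy (densityMeasure g) n (unstableSet ψ n l) ≤ s) :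
    ((Measure.pi fun _ => π).prod π) (disagreementSet ψ n l) ≤
      ENNReal.ofReal ε + (s + s) +
        volume (Metric.closedBall (0 : Pt d) 1) * (ENNReal.ofReal M *
          (2 * ENNReal.ofReal M) ^ (1 / (p - 1))) *
            ENNReal.ofReal (l * ε ^ ((p - 2) / (d * (p - 1)))) ^ d := by
  set μ := (Measure.pi fun _ : Fin n => π).prod π
  refine (measure_union_le _ _).trans (add_le_add ((measure_union_le _ _).trans (add_le_add ?_
    ((measure_union_le _ _).trans (add_le_add ?_ ?_)))) ?_)
  · exact ((measurePreserving_snd (μ := Measure.pi fun _ : Fin n => π)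
      (ν := π)).measure_preimage_le {z | z.1 ≠ z.2}).trans (hπ.measure_ne_le.trans h)
  · exact ((hπ.measurePreserving_sample_fst hf n).measure_preimage_le _).trans hsf
  · exact ((hπ.measurePreserving_sample_snd hg n).measure_preimage_le _).trans hsg
  · set r := l / (n : ℝ) ^ (1 / (d : ℝ)) with hr
    set B := ENNReal.ofReal M * ((2 * ENNReal.ofReal M) ^ (1 / (p - 1)) *
      ENNReal.ofReal ε ^ ((p - 2) / (p - 1))) with hB
    have hi (i : Fin n) : μ ((fun q => (q.1 i, q.2)) ⁻¹' nearDisagreement d r) ≤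
        volume (Metric.closedBall (0 : Pt d) r) * B := by
      have hmp : MeasurePreserving (fun q : (Fin n → Pt d × Pt d) × (Pt d × Pt d) => (q.1 i, q.2))
          μ (π.prod π) :=
        (measurePreserving_eval (fun _ : Fin n => π) i).prod (MeasurePreserving.id π)
      exact (hmp.measure_preimage_le _).trans ((hπ.measure_ne_near_le hf hg r).trans
        (lintegral_near_density_le hf hg hp hfM hgM h r))
    have hd0 : (d : ℝ) ≠ 0 := by exact_mod_cast (by omega : d ≠ 0)
    have hpow : ENNReal.ofReal l ^ d * ENNReal.ofReal ε ^ ((p - 2) / (p - 1)) =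
        ENNReal.ofReal (l * ε ^ ((p - 2) / (d * (p - 1)))) ^ d := by
      have hp1 : p - 1 ≠ 0 := by linarith
      rw [ENNReal.ofReal_mul' (by positivity), mul_pow, ← ENNReal.ofReal_rpow_of_pos hε,
        ← ENNReal.rpow_natCast, ← ENNReal.rpow_natCast, ← ENNReal.rpow_mul]
      congr 2
      field_simp
    calc _ ≤ ∑ i, μ ((fun q => (q.1 i, q.2)) ⁻¹' nearDisagreement d r) :=
          measure_iUnion_fintype_le _ _
      _ ≤ ∑ _ : Fin n, volume (Metric.closedBall (0 : Pt d) r) * B :=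
          Finset.sum_le_sum fun i _ => hi i
      _ = (n * volume (Metric.closedBall (0 : Pt d) r)) * B := by
          simp [mul_assoc]
      _ = _ := by
          rw [hr, natCast_mul_volume_closedBall hd hn, hB, ← hpow]
          ring

/-- The moment condition bounds add-one costs only, but by Efron–Stein it makes the statistic itself
square integrable; its expectation is therefore a genuine integral. -/
lemma MomentCondition.memLp_two {p M : ℝ} {ψ : Multiset (Pt d) → ℝ}
    (hψ : Measurable ψ) (hE : MomentCondition ψ (densityClass d p M)) {g : Pt d → ℝ}
    (hg : IsProbDensity g) (hgM : eLpNorm g (ENNReal.ofReal p) volume ≤ ENNReal.ofReal M)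
    {n : ℕ} (hn : 1 ≤ n) :
    MemLp (fun x => ψ (rescale n (toMultiset x))) 2
      (Measure.pi fun _ : Fin n => densityMeasure g) := by
  obtain ⟨a, ha, Ea, hEa⟩ := hE
  have := hg.isProb
  have ha0 : 0 < a := by linarith
  have hm := hEa (densityMeasure g) ⟨g, hg, rfl, hgM⟩ n hn
  have hK := measurable_sampleAddOneCost hψ n
  have h1 := lintegral_sq_sub_le_of_eq_off (μ := sampleWithCopy (densityMeasure g) n) ha hK
    (V := fun _ => 0) measurable_const hm (by simp [Real.zero_rpow ha0.ne']) (s := Set.univ)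
    (by simp)
  simp only [sub_zero] at h1
  have h2 := lintegral_sq_sub_le_of_addOne (densityMeasure g)
    (hψ.comp (measurable_rescale_toMultiset n n)) hK fun z i w => stat_sub_stat_update ψ z i w
  have hfin : ∫⁻ q, ENNReal.ofReal (sampleAddOneCost ψ n q ^ 2)
      ∂((Measure.pi fun _ : Fin n => densityMeasure g).prod (densityMeasure g)) ≠ ∞ := by
    have : IsProbabilityMeasure (sampleWithCopy (densityMeasure g) n) := by
      unfold sampleWithCopy; infer_instance
    refine (h1.trans_lt ?_).ne
    rw [measure_univ, ENNReal.one_rpow, mul_one]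
    refine ENNReal.rpow_lt_top_of_nonneg (by positivity) ?_
    exact ENNReal.mul_ne_top (ENNReal.rpow_ne_top_of_nonneg (by linarith) (by simp)) (by simp)
  have hfin' := ENNReal.mul_ne_top (a := 4 * (n : ℝ≥0∞)) (by finiteness) hfin
  rw [← ENNReal.ofReal_toReal hfin'] at h2
  exact (memLp_two_and_integral_abs_sub_le _ (hψ.comp (measurable_rescale_toMultiset n n)) h2).1

/-- For coupled samples from `f` and a density at `L¹` distance at most `ε`, the mean squared
difference of two copies of `ψ(n^{1/d} X_n) - ψ(n^{1/d} Y_n)` is at most `n η(ε)`, where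
`η(ε) → 0` does not depend on `n`. -/
theorem exists_variance_modulus (hd : 1 ≤ d) {f : Pt d → ℝ} (hf : IsProbDensity f) {p M : ℝ}
    (hp : 2 < p) (hfM : eLpNorm f (ENNReal.ofReal p) volume ≤ ENNReal.ofReal M)
    {ψ : Multiset (Pt d) → ℝ} (hψ : Measurable ψ) (hE : MomentCondition ψ (densityClass d p M))
    (hS : StabilizationCondition ψ (densityClass d p M) (densityMeasure f)
      ((p - 2) / (d * (p - 1)))) :
    ∃ η : ℝ → ℝ≥0∞, Tendsto η (𝓝[>] 0) (𝓝 0) ∧ ∀ ε : ℝ, 0 < ε → ∀ g : Pt d → ℝ,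
      IsProbDensity g → eLpNorm g (ENNReal.ofReal p) volume ≤ ENNReal.ofReal M →
      ∫⁻ x, ENNReal.ofReal |f x - g x| ≤ ENNReal.ofReal ε →
      ∀ π : Measure (Pt d × Pt d), IsDensityCoupling f g π → ∀ n : ℕ, 1 ≤ n →
        ∫⁻ z, ∫⁻ z', ENNReal.ofReal
          (((ψ (rescale n (toMultiset fun i => (z i).1)) -
              ψ (rescale n (toMultiset fun i => (z i).2))) -
            (ψ (rescale n (toMultiset fun i => (z' i).1)) -
              ψ (rescale n (toMultiset fun i => (z' i).2)))) ^ 2)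
          ∂(Measure.pi fun _ : Fin n => π) ∂(Measure.pi fun _ : Fin n => π) ≤ n * η ε := by
  obtain ⟨a, ha, Ea, hEa⟩ := hE
  obtain ⟨l, hl, hstab⟩ := hS
  set s : ℝ → ℝ≥0∞ := fun ε => ⨆ G ∈ densityClass d p M ∩ tvClosedBall (densityMeasure f) ε,
    ⨆ n : ℕ, ⨆ _ : 1 ≤ n, sampleWithCopy G n (unstableSet ψ n (l ε)) with hs
  have hs0 : Tendsto s (𝓝[>] 0) (𝓝 0) := hstab
  have ha0 : 0 < a := by linarith
  have h2a : 0 < 1 - 2 / a := by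
    rw [sub_pos, div_lt_one ha0]
    exact ha
  have hp1 : 0 < p - 1 := by linarith
  set C₀ : ℝ≥0∞ := volume (Metric.closedBall (0 : Pt d) 1) * (ENNReal.ofReal M *
    (2 * ENNReal.ofReal M) ^ (1 / (p - 1))) with hC₀
  have hC₀top : C₀ ≠ ∞ := by
    refine ENNReal.mul_ne_top Metric.isBounded_closedBall.measure_lt_top.ne
      (ENNReal.mul_ne_top (by simp) (ENNReal.rpow_ne_top_of_nonneg (by positivity) ?_))
    finiteness
  set θ : ℝ → ℝ≥0∞ := fun ε => ENNReal.ofReal ε + (s ε + s ε) +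
    C₀ * ENNReal.ofReal (l ε * ε ^ ((p - 2) / (d * (p - 1)))) ^ d with hθ
  set E₁ : ℝ≥0∞ := 2 ^ (a - 1) * (ENNReal.ofReal Ea + ENNReal.ofReal Ea) with hE₁
  have hE₁top : E₁ ^ (2 / a) ≠ ∞ := by
    refine ENNReal.rpow_ne_top_of_nonneg (by positivity) (ENNReal.mul_ne_top
      (ENNReal.rpow_ne_top_of_nonneg (by linarith) (by simp)) (by simp))
  have hθ0 : Tendsto θ (𝓝[>] 0) (𝓝 0) := by
    have t1 : Tendsto (fun ε : ℝ => ENNReal.ofReal ε) (𝓝[>] 0) (𝓝 0) := by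
      have := (ENNReal.continuous_ofReal.tendsto 0).mono_left
        (nhdsWithin_le_nhds (s := Set.Ioi (0 : ℝ)))
      simpa using this
    have t2 : Tendsto (fun ε : ℝ => C₀ *
        ENNReal.ofReal (l ε * ε ^ ((p - 2) / (d * (p - 1)))) ^ d) (𝓝[>] 0) (𝓝 0) := by
      have h1 := ENNReal.Tendsto.pow (n := d) (ENNReal.tendsto_ofReal hl)
      have h2 := ENNReal.Tendsto.const_mul h1 (Or.inr hC₀top)
      simpa [show d ≠ 0 by omega] using h2
    simpa using (t1.add (hs0.add hs0)).add t2
  refine ⟨fun ε => 4 * (E₁ ^ (2 / a) * θ ε ^ (1 - 2 / a)), ?_, ?_⟩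
  · have h1 := (hθ0.ennrpow_const (1 - 2 / a))
    have h2 := ENNReal.Tendsto.const_mul h1 (Or.inr hE₁top)
    have h3 := ENNReal.Tendsto.const_mul h2 (Or.inr (by simp : (4 : ℝ≥0∞) ≠ ∞))
    simpa [ENNReal.zero_rpow_of_pos h2a] using h3
  intro ε hε g hg hgM hfg π hπ n hn
  have := hπ.isProbabilityMeasure hf
  have hfC : densityMeasure f ∈ densityClass d p M := ⟨f, hf, rfl, hfM⟩
  have hgC : densityMeasure g ∈ densityClass d p M := ⟨g, hg, rfl, hgM⟩
  have hle {G : Measure (Pt d)} (hG : G ∈ densityClass d p M)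
      (hG' : G ∈ tvClosedBall (densityMeasure f) ε) :
      sampleWithCopy G n (unstableSet ψ n (l ε)) ≤ s ε :=
    le_iSup₂_of_le G ⟨hG, hG'⟩ (le_iSup₂_of_le n hn le_rfl)
  have hsf := hle hfC (densityMeasure_mem_tvClosedBall hf hf hε.le (by simp))
  have hsg := hle hgC (densityMeasure_mem_tvClosedBall hf hg hε.le hfg)
  have hA := measure_disagreementSet_le hd hf hg hp hε hfM hgM hfg hπ ψ hn (l ε) hsf hsg
  have mpf := hπ.measurePreserving_sample_fst hf n
  have mpg := hπ.measurePreserving_sample_snd hg n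
  have hK := measurable_sampleAddOneCost hψ n
  have hstat : Measurable fun x : Fin n → Pt d => ψ (rescale n (toMultiset x)) :=
    hψ.comp (measurable_rescale_toMultiset n n)
  have hKa : Measurable fun q => ENNReal.ofReal (|sampleAddOneCost ψ n q| ^ a) := by fun_prop
  have hHolder := lintegral_sq_sub_le_of_eq_off (μ := (Measure.pi fun _ : Fin n => π).prod π) ha
    (hK.comp mpf.measurable) (hK.comp mpg.measurable) (E := ENNReal.ofReal Ea)
    ((mpf.lintegral_comp hKa).trans_le (hEa _ hfC n hn))
    ((mpg.lintegral_comp hKa).trans_le (hEa _ hgC n hn)) (s := disagreementSet ψ n (l ε))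
    fun q hq => sampleAddOneCost_eq_of_notMem_disagreementSet hn hq
  have hES := lintegral_sq_sub_le_of_addOne π
    (h := fun z : Fin n → Pt d × Pt d => ψ (rescale n (toMultiset fun i => (z i).1)) -
      ψ (rescale n (toMultiset fun i => (z i).2)))
    ((hstat.comp (by fun_prop)).sub (hstat.comp (by fun_prop)))
    (K := fun q => sampleAddOneCost ψ n (fun i => (q.1 i).1, q.2.1) -
      sampleAddOneCost ψ n (fun i => (q.1 i).2, q.2.2))
    ((hK.comp mpf.measurable).sub (hK.comp mpg.measurable)) ?_
  · refine hES.trans ?_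
    calc _ ≤ 4 * (n : ℝ≥0∞) * (E₁ ^ (2 / a) * θ ε ^ (1 - 2 / a)) := by
          gcongr
          refine hHolder.trans ?_
          gcongr
      _ = _ := by ring
  · intro z i w
    have e1 : (fun j => (Function.update z i w j).1) =
        Function.update (fun j => (z j).1) i w.1 := by
      ext1 j
      exact Function.apply_update (fun _ => Prod.fst) z i w j
    have e2 : (fun j => (Function.update z i w j).2) =
        Function.update (fun j => (z j).2) i w.2 := by
      ext1 j
      exact Function.apply_update (fun _ => Prod.snd) z i w j
    have s1 := stat_sub_stat_update ψ (fun j => (z j).1) i w.1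
    have s2 := stat_sub_stat_update ψ (fun j => (z j).2) i w.2
    simp only [e1, e2]
    linarith

end VarianceModulus

/-! ### From variances to Lipschitz test functions -/

section BootstrapLaw

variable {d k : ℕ}

lemma measurable_scaledStat {ψ : Multiset (Pt d) → (Fin k → ℝ)} (hψ : Measurable ψ) (n : ℕ) :
    Measurable (scaledStat ψ n) :=
  hψ.comp (measurable_rescale_toMultiset n n)

lemma isProbabilityMeasure_bootstrapLaw {ψ : Multiset (Pt d) → (Fin k → ℝ)} (hψ : Measurable ψ)
    (n : ℕ) (Q : Measure (Pt d)) [IsProbabilityMeasure Q] :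
    IsProbabilityMeasure (bootstrapLaw ψ n Q) := by
  have := measurable_scaledStat hψ n
  exact Measure.isProbabilityMeasure_map (Measurable.aemeasurable (by fun_prop))

lemma map_firstObs {Ω : Type*} [MeasurableSpace Ω] {P : Measure Ω} [IsProbabilityMeasure P]
    {F : Measure (Pt d)} {X : ℕ → Ω → Pt d} (hX : ∀ i, Measurable (X i))
    (hXF : ∀ i, P.map (X i) = F) (hXindep : iIndepFun X P) (n : ℕ) :
    P.map (firstObs X n) = Measure.pi fun _ : Fin n => F := by
  have h := iIndepFun.map_fun_eq_pi_map (f := fun i : Fin n => X i)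
    (fun i => (hX i).aemeasurable) (hXindep.precomp Fin.val_injective)
  simp only [hXF] at h
  exact h

lemma map_centredStat {Ω : Type*} [MeasurableSpace Ω] {P : Measure Ω} [IsProbabilityMeasure P]
    {F : Measure (Pt d)} {X : ℕ → Ω → Pt d} (hX : ∀ i, Measurable (X i))
    (hXF : ∀ i, P.map (X i) = F) (hXindep : iIndepFun X P)
    {ψ : Multiset (Pt d) → (Fin k → ℝ)} (hψ : Measurable ψ) (n : ℕ) :
    P.map (centredStat P ψ X n) = bootstrapLaw ψ n F := by
  have hs := measurable_scaledStat hψ n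
  have hobs : Measurable (firstObs X n) := measurable_pi_lambda _ fun i => hX i
  have hint : ∫ ω, scaledStat ψ n (firstObs X n ω) ∂P =
      ∫ y, scaledStat ψ n y ∂(Measure.pi fun _ : Fin n => F) := by
    rw [← map_firstObs hX hXF hXindep n, integral_map hobs.aemeasurable
      hs.aestronglyMeasurable]
  rw [bootstrapLaw, ← map_firstObs hX hXF hXindep n, Measure.map_map (by fun_prop) hobs,
    map_firstObs hX hXF hXindep n, ← hint]
  rfl

lemma measurable_centredStat {Ω : Type*} [MeasurableSpace Ω] (P : Measure Ω)
    {X : ℕ → Ω → Pt d} (hX : ∀ i, Measurable (X i))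
    {ψ : Multiset (Pt d) → (Fin k → ℝ)} (hψ : Measurable ψ) (n : ℕ) :
    Measurable (centredStat P ψ X n) := by
  have hobs : Measurable (firstObs X n) := measurable_pi_lambda _ fun i => hX i
  exact (((measurable_scaledStat hψ n).comp hobs).sub_const _).const_smul (√(n : ℝ))⁻¹

lemma tendstoInDistribution_centredStat_iff {Ω : Type*} [MeasurableSpace Ω] {P : Measure Ω}
    [IsProbabilityMeasure P] {F : Measure (Pt d)} {X : ℕ → Ω → Pt d}
    (hX : ∀ i, Measurable (X i)) (hXF : ∀ i, P.map (X i) = F) (hXindep : iIndepFun X P)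
    {ψ : Multiset (Pt d) → (Fin k → ℝ)} (hψ : Measurable ψ) (m : ℕ → ℕ)
    (G : Measure (Fin k → ℝ)) [IsProbabilityMeasure G] :
    TendstoInDistribution (fun n => centredStat P ψ X (m n)) atTop id (fun _ => P) G ↔
      ∀ v : (Fin k → ℝ) →ᵇ ℝ,
        Tendsto (fun n => ∫ y, v y ∂(bootstrapLaw ψ (m n) F)) atTop (𝓝 (∫ y, v y ∂G)) := by
  constructor
  · intro h v
    have := ProbabilityMeasure.tendsto_iff_forall_integral_tendsto.1 h.tendsto v
    simpa [map_centredStat hX hXF hXindep hψ] using this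
  · intro h
    refine ⟨fun n => (measurable_centredStat P hX hψ (m n)).aemeasurable, aemeasurable_id, ?_⟩
    refine ProbabilityMeasure.tendsto_iff_forall_integral_tendsto.2 fun v => ?_
    simpa [map_centredStat hX hXF hXindep hψ] using h v

/-- A bound `n δ` on the mean squared differences of the coupled statistics bounds the distance of
their normalized laws, as measured by a Lipschitz test function. -/
lemma abs_integral_bootstrapLaw_sub_le {f g : Pt d → ℝ} (hf : IsProbDensity f)
    (hg : IsProbDensity g) {p M : ℝ}
    (hfM : eLpNorm f (ENNReal.ofReal p) volume ≤ ENNReal.ofReal M)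
    (hgM : eLpNorm g (ENNReal.ofReal p) volume ≤ ENNReal.ofReal M)
    {ψ : Multiset (Pt d) → (Fin k → ℝ)} (hψ : Measurable ψ)
    (hE : ∀ j, MomentCondition (fun S => ψ S j) (densityClass d p M))
    {π : Measure (Pt d × Pt d)} (hπ : IsDensityCoupling f g π) {n : ℕ} (hn : 1 ≤ n) {δ : ℝ}
    (hδ : ∀ j, ∫⁻ z, ∫⁻ z', ENNReal.ofReal
          (((ψ (rescale n (toMultiset fun i => (z i).1)) j -
              ψ (rescale n (toMultiset fun i => (z i).2)) j) -
            (ψ (rescale n (toMultiset fun i => (z' i).1)) j -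
              ψ (rescale n (toMultiset fun i => (z' i).2)) j)) ^ 2)
          ∂(Measure.pi fun _ : Fin n => π) ∂(Measure.pi fun _ : Fin n => π) ≤
        n * ENNReal.ofReal δ)
    {v : (Fin k → ℝ) → ℝ} {C : ℝ} (hC : ∀ x y, dist (v x) (v y) ≤ C) {K : NNReal}
    (hK : LipschitzWith K v) :
    |∫ y, v y ∂(bootstrapLaw ψ n (densityMeasure g)) -
      ∫ y, v y ∂(bootstrapLaw ψ n (densityMeasure f))| ≤ K * (k * √δ) := by
  have := hf.isProb
  have := hg.isProb
  have := hπ.isProbabilityMeasure hf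
  have hn0 : (0 : ℝ) < n := by exact_mod_cast hn
  have hsn : 0 < √(n : ℝ) := Real.sqrt_pos.2 hn0
  have hsm := measurable_scaledStat hψ n
  set μ := Measure.pi fun _ : Fin n => π with hμ
  have mpf := hπ.measurePreserving_pi_fst hf n
  have mpg := hπ.measurePreserving_pi_snd hg n
  set pf : (Fin n → Pt d × Pt d) → (Fin n → Pt d) := fun z i => (z i).1 with hpf
  set pg : (Fin n → Pt d × Pt d) → (Fin n → Pt d) := fun z i => (z i).2 with hpg
  set cf := ∫ y, scaledStat ψ n y ∂(Measure.pi fun _ : Fin n => densityMeasure f) with hcf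
  set cg := ∫ y, scaledStat ψ n y ∂(Measure.pi fun _ : Fin n => densityMeasure g) with hcg
  set Tf : (Fin n → Pt d × Pt d) → (Fin k → ℝ) :=
    fun z => (√(n : ℝ))⁻¹ • (scaledStat ψ n (pf z) - cf) with hTf
  set Tg : (Fin n → Pt d × Pt d) → (Fin k → ℝ) :=
    fun z => (√(n : ℝ))⁻¹ • (scaledStat ψ n (pg z) - cg) with hTg
  have hTfm : Measurable Tf := ((hsm.comp mpf.measurable).sub_const cf).const_smul (√(n : ℝ))⁻¹
  have hTgm : Measurable Tg := ((hsm.comp mpg.measurable).sub_const cg).const_smul (√(n : ℝ))⁻¹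
  have hLf : bootstrapLaw ψ n (densityMeasure f) = μ.map Tf := by
    rw [bootstrapLaw, ← mpf.map_eq, Measure.map_map (by fun_prop) mpf.measurable, mpf.map_eq]
    rfl
  have hLg : bootstrapLaw ψ n (densityMeasure g) = μ.map Tg := by
    rw [bootstrapLaw, ← mpg.map_eq, Measure.map_map (by fun_prop) mpg.measurable, mpg.map_eq]
    rfl
  have hvc := hK.continuous
  have hvint {T : (Fin n → Pt d × Pt d) → (Fin k → ℝ)} (hT : Measurable T) :
      Integrable (fun z => v (T z)) μ := by
    refine Integrable.of_bound (hvc.measurable.comp hT).aestronglyMeasurable (|v 0| + C)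
      (ae_of_all _ fun z => ?_)
    have h1 := hC (T z) 0
    rw [Real.dist_eq] at h1
    have h2 := abs_add_le (v (T z) - v 0) (v 0)
    rw [sub_add_cancel] at h2
    rw [Real.norm_eq_abs]
    linarith
  -- the coordinates of the difference of the statistics on the coupled samples
  set h : Fin k → (Fin n → Pt d × Pt d) → ℝ :=
    fun j z => scaledStat ψ n (pf z) j - scaledStat ψ n (pg z) j with hh
  have hhm (j : Fin k) : Measurable (h j) :=
    ((measurable_pi_apply j).comp (hsm.comp mpf.measurable)).sub
      ((measurable_pi_apply j).comp (hsm.comp mpg.measurable))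
  have hLpf (j : Fin k) : MemLp (fun y => scaledStat ψ n y j) 2
      (Measure.pi fun _ : Fin n => densityMeasure f) :=
    (hE j).memLp_two ((measurable_pi_apply j).comp hψ) hf hfM hn
  have hLpg (j : Fin k) : MemLp (fun y => scaledStat ψ n y j) 2
      (Measure.pi fun _ : Fin n => densityMeasure g) :=
    (hE j).memLp_two ((measurable_pi_apply j).comp hψ) hg hgM hn
  have hcj (j : Fin k) : ∫ z, h j z ∂μ = cf j - cg j := by
    have e1 : ∫ z, scaledStat ψ n (pf z) j ∂μ = cf j := by
      rw [hcf, eval_integral fun i => (hLpf i).integrable (by norm_num), ← mpf.map_eq]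
      exact (integral_map mpf.measurable.aemeasurable
        ((measurable_pi_apply j).comp hsm).aestronglyMeasurable).symm
    have e2 : ∫ z, scaledStat ψ n (pg z) j ∂μ = cg j := by
      rw [hcg, eval_integral fun i => (hLpg i).integrable (by norm_num), ← mpg.map_eq]
      exact (integral_map mpg.measurable.aemeasurable
        ((measurable_pi_apply j).comp hsm).aestronglyMeasurable).symm
    rw [← e1, ← e2]
    exact integral_sub (((hLpf j).comp_measurePreserving mpf).integrable (by norm_num))
      (((hLpg j).comp_measurePreserving mpg).integrable (by norm_num))
  have hvar (j : Fin k) := memLp_two_and_integral_abs_sub_le μ (hhm j) (C := n * δ) (by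
    rw [ENNReal.ofReal_mul hn0.le, ENNReal.ofReal_natCast]
    exact hδ j)
  have hhint (j : Fin k) : Integrable (fun z => |h j z - ∫ z', h j z' ∂μ|) μ :=
    (((hvar j).1.integrable (by norm_num)).sub (integrable_const _)).abs
  have hpt (z : Fin n → Pt d × Pt d) : |v (Tg z) - v (Tf z)| ≤
      ∑ j, K * ((√(n : ℝ))⁻¹ * |h j z - ∫ z', h j z' ∂μ|) := by
    rw [← Real.dist_eq, ← Finset.mul_sum]
    refine (hK.dist_le_mul _ _).trans (mul_le_mul_of_nonneg_left ?_ K.2)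
    have hnn (j : Fin k) : 0 ≤ (√(n : ℝ))⁻¹ * |h j z - ∫ z', h j z' ∂μ| := by positivity
    refine (dist_pi_le_iff (Finset.sum_nonneg fun j _ => hnn j)).2 fun j => ?_
    refine le_trans (le_of_eq ?_) (Finset.single_le_sum (fun j _ => hnn j) (Finset.mem_univ j))
    rw [Real.dist_eq, hcj, hTf, hTg]
    simp only [Pi.smul_apply, Pi.sub_apply, smul_eq_mul, hh]
    rw [← mul_sub, abs_mul, abs_of_pos (inv_pos.2 hsn), abs_sub_comm]
    congr 2
    ring
  rw [hLf, hLg, integral_map hTgm.aemeasurable hvc.aestronglyMeasurable,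
    integral_map hTfm.aemeasurable hvc.aestronglyMeasurable, ← integral_sub (hvint hTgm)
      (hvint hTfm)]
  calc _ ≤ ∫ z, |v (Tg z) - v (Tf z)| ∂μ := abs_integral_le_integral_abs
    _ ≤ ∫ z, ∑ j, K * ((√(n : ℝ))⁻¹ * |h j z - ∫ z', h j z' ∂μ|) ∂μ :=
        integral_mono ((hvint hTgm).sub (hvint hTfm)).abs
          (integrable_finsetSum _ fun j _ => ((hhint j).const_mul _).const_mul _) hpt
    _ = ∑ j, K * ((√(n : ℝ))⁻¹ * ∫ z, |h j z - ∫ z', h j z' ∂μ| ∂μ) := by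
        rw [integral_finsetSum _ fun j _ => ((hhint j).const_mul _).const_mul _]
        simp_rw [integral_const_mul]
    _ ≤ ∑ _ : Fin k, (K : ℝ) * √δ := by
        refine Finset.sum_le_sum fun j _ => mul_le_mul_of_nonneg_left ?_ K.2
        have h1 := (hvar j).2
        rw [Real.sqrt_mul hn0.le] at h1
        rw [inv_mul_le_iff₀ hsn]
        exact h1
    _ = K * (k * √δ) := by
        simp only [Finset.sum_const, Finset.card_univ, Fintype.card_fin, nsmul_eq_mul]
        ring

/-- The probability densities `g` with `‖g‖_p ≤ M` and `‖f - g‖_1 ≤ ε`. -/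
def densitiesNear (f : Pt d → ℝ) (p M ε : ℝ) : Set (Pt d → ℝ) :=
  {g | IsProbDensity g ∧ eLpNorm g (ENNReal.ofReal p) volume ≤ ENNReal.ofReal M ∧
    ∫⁻ x, ENNReal.ofReal |f x - g x| ≤ ENNReal.ofReal ε}

/-- The laws of the normalized statistics under `f` and under a nearby density are close, uniformly
in the sample size. -/
theorem exists_uniform_lipschitz_closeness (hd : 1 ≤ d) {f : Pt d → ℝ} (hf : IsProbDensity f)
    {p M : ℝ} (hp : 2 < p) (hfM : eLpNorm f (ENNReal.ofReal p) volume ≤ ENNReal.ofReal M)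
    {ψ : Multiset (Pt d) → (Fin k → ℝ)} (hψ : Measurable ψ)
    (hE : ∀ j, MomentCondition (fun S => ψ S j) (densityClass d p M))
    (hS : ∀ j, StabilizationCondition (fun S => ψ S j) (densityClass d p M) (densityMeasure f)
      ((p - 2) / (d * (p - 1))))
    {v : (Fin k → ℝ) → ℝ} {C : ℝ} (hC : ∀ x y, dist (v x) (v y) ≤ C) {K : NNReal}
    (hK : LipschitzWith K v) {δ : ℝ} (hδ : 0 < δ) :
    ∃ ε : ℝ, 0 < ε ∧ ∀ g ∈ densitiesNear f p M ε, ∀ n : ℕ, 1 ≤ n →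
      |∫ y, v y ∂(bootstrapLaw ψ n (densityMeasure g)) -
        ∫ y, v y ∂(bootstrapLaw ψ n (densityMeasure f))| < δ := by
  choose η hη0 hη using fun j => exists_variance_modulus hd hf hp hfM
    ((measurable_pi_apply j).comp hψ) (hE j) (hS j)
  -- chosen so that `K k √δ' ≤ δ / 2`; the added `1` covers `K = 0` and `k = 0`
  set δ' := (δ / (2 * (K * k + 1))) ^ 2 with hδ'
  have hpos : 0 < (K : ℝ) * k + 1 := by positivity
  have hδ'0 : 0 < δ' := by positivity
  have hev : ∀ᶠ ε in 𝓝[>] (0 : ℝ), 0 < ε ∧ ∀ j, η j ε ≤ ENNReal.ofReal δ' := by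
    refine (eventually_mem_nhdsWithin (s := Set.Ioi (0 : ℝ))).and (eventually_all.2 fun j => ?_)
    exact (hη0 j).eventually (ge_mem_nhds (ENNReal.ofReal_pos.2 hδ'0))
  obtain ⟨ε, hε, hεη⟩ := hev.exists
  refine ⟨ε, hε, fun g hg n hn => ?_⟩
  obtain ⟨π, hπ⟩ := exists_isDensityCoupling hf hg.1
  refine (abs_integral_bootstrapLaw_sub_le hf hg.1 hfM hg.2.1 hψ hE hπ hn (δ := δ')
    (fun j => (hη j ε hε g hg.1 hg.2.1 hg.2.2 π hπ n hn).trans (by gcongr; exact hεη j))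
    hC hK).trans_lt ?_
  rw [hδ', Real.sqrt_sq (by positivity)]
  have : (K : ℝ) * (k * (δ / (2 * (K * k + 1)))) = (K * k) / (K * k + 1) * (δ / 2) := by
    field_simp
  rw [this]
  have h1 : ((K : ℝ) * k) / (K * k + 1) ≤ 1 := by
    rw [div_le_one hpos]
    linarith
  nlinarith

end BootstrapLaw

/-! ### Weak limits along densities close to the true one -/

section WeakConvergence

variable {d k : ℕ}

/-- If at each late index some density arbitrarily near `f` has a law close to `G`, the laws under
`f` converge to `G`. -/
theorem tendsto_bootstrapLaw_of_forall_exists_near (hd : 1 ≤ d) {f : Pt d → ℝ}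
    (hf : IsProbDensity f) {p M : ℝ} (hp : 2 < p)
    (hfM : eLpNorm f (ENNReal.ofReal p) volume ≤ ENNReal.ofReal M)
    {ψ : Multiset (Pt d) → (Fin k → ℝ)} (hψ : Measurable ψ)
    (hE : ∀ j, MomentCondition (fun S => ψ S j) (densityClass d p M))
    (hS : ∀ j, StabilizationCondition (fun S => ψ S j) (densityClass d p M) (densityMeasure f)
      ((p - 2) / (d * (p - 1))))
    {m : ℕ → ℕ} (hm : Tendsto m atTop atTop) {G : Measure (Fin k → ℝ)} [IsProbabilityMeasure G]
    (h : ∀ v : (Fin k → ℝ) →ᵇ ℝ, ∀ δ : ℝ, 0 < δ → ∀ ε : ℝ, 0 < ε → ∀ᶠ i in atTop,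
      ∃ g ∈ densitiesNear f p M ε,
        |∫ y, v y ∂(bootstrapLaw ψ (m i) (densityMeasure g)) - ∫ y, v y ∂G| < δ)
    (v : (Fin k → ℝ) →ᵇ ℝ) :
    Tendsto (fun i => ∫ y, v y ∂(bootstrapLaw ψ (m i) (densityMeasure f))) atTop
      (𝓝 (∫ y, v y ∂G)) := by
  have := hf.isProb
  refine (ProbabilityMeasure.tendsto_iff_forall_integral_tendsto
    (μs := fun i => ⟨bootstrapLaw ψ (m i) (densityMeasure f),
      isProbabilityMeasure_bootstrapLaw hψ _ _⟩) (μ := ⟨G, inferInstance⟩)).1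
    (tendsto_iff_forall_lipschitz_integral_tendsto.2 ?_) v
  rintro u ⟨C, hC⟩ ⟨K, hK⟩
  rw [Metric.tendsto_nhds]
  intro δ hδ
  obtain ⟨ε, hε, hcl⟩ := exists_uniform_lipschitz_closeness hd hf hp hfM hψ hE hS hC hK
    (half_pos hδ)
  filter_upwards [h (BoundedContinuousFunction.mkOfBound ⟨u, hK.continuous⟩ C hC) (δ / 2)
    (half_pos hδ) ε hε, hm.eventually_ge_atTop 1] with i ⟨g, hg, hi⟩ hmi
  have h1 := hcl g hg (m i) hmi
  rw [abs_sub_comm] at h1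
  exact (abs_sub_le _ _ _).trans_lt ((add_lt_add h1 hi).trans_eq (add_halves δ))

/-- If the laws under `f` converge to `G`, so do the laws under densities near `f`, uniformly for
each test function. The test function need not be Lipschitz. -/
theorem exists_uniform_weak_closeness (hd : 1 ≤ d) {f : Pt d → ℝ}
    (hf : IsProbDensity f) {p M : ℝ} (hp : 2 < p)
    (hfM : eLpNorm f (ENNReal.ofReal p) volume ≤ ENNReal.ofReal M)
    {ψ : Multiset (Pt d) → (Fin k → ℝ)} (hψ : Measurable ψ)
    (hE : ∀ j, MomentCondition (fun S => ψ S j) (densityClass d p M))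
    (hS : ∀ j, StabilizationCondition (fun S => ψ S j) (densityClass d p M) (densityMeasure f)
      ((p - 2) / (d * (p - 1))))
    {m : ℕ → ℕ} (hm : Tendsto m atTop atTop) {G : Measure (Fin k → ℝ)} [IsProbabilityMeasure G]
    (h : ∀ v : (Fin k → ℝ) →ᵇ ℝ,
      Tendsto (fun i => ∫ y, v y ∂(bootstrapLaw ψ (m i) (densityMeasure f))) atTop
        (𝓝 (∫ y, v y ∂G)))
    (v : (Fin k → ℝ) →ᵇ ℝ) {δ : ℝ} (hδ : 0 < δ) :
    ∃ ε : ℝ, 0 < ε ∧ ∀ᶠ i in atTop, ∀ g ∈ densitiesNear f p M ε,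
      |∫ y, v y ∂(bootstrapLaw ψ (m i) (densityMeasure g)) - ∫ y, v y ∂G| < δ := by
  -- a single filter on pairs (index, density) records both limits
  let D := {g : Pt d → ℝ // IsProbDensity g ∧
    eLpNorm g (ENNReal.ofReal p) volume ≤ ENNReal.ofReal M}
  let 𝓤 : Filter D := comap (fun g => ∫⁻ x, ENNReal.ofReal |f x - g.1 x|) (𝓝 0)
  have hD (g : D) : IsProbabilityMeasure (densityMeasure g.1) := g.2.1.isProb
  have hnear {ε : ℝ} (hε : 0 < ε) :
      ∀ᶠ q : ℕ × D in atTop ×ˢ 𝓤, q.2.1 ∈ densitiesNear f p M ε := by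
    have h0 : ∀ᶠ t : ℝ≥0∞ in 𝓝 0, t ≤ ENNReal.ofReal ε :=
      ge_mem_nhds (ENNReal.ofReal_pos.2 hε)
    have h1 : ∀ᶠ g : D in 𝓤, g.1 ∈ densitiesNear f p M ε :=
      (h0.comap _).mono fun g hg => ⟨g.2.1, g.2.2, hg⟩
    exact tendsto_snd.eventually h1
  have hlim := (ProbabilityMeasure.tendsto_iff_forall_integral_tendsto
    (μs := fun q : ℕ × D => ⟨bootstrapLaw ψ (m q.1) (densityMeasure q.2.1),
      isProbabilityMeasure_bootstrapLaw hψ _ _⟩) (μ := ⟨G, inferInstance⟩) (F := atTop ×ˢ 𝓤)).1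
    (tendsto_iff_forall_lipschitz_integral_tendsto.2 ?_) v
  · have hev := (Metric.tendsto_nhds.1 hlim) δ hδ
    obtain ⟨A, hA, B, hB, hAB⟩ := eventually_prod_iff.1 hev
    obtain ⟨t, ht, htB⟩ := mem_comap.1 hB
    obtain ⟨e, he, het⟩ := ENNReal.nhds_zero_basis_Iic.mem_iff.1 ht
    obtain ⟨ε, hε, hεe⟩ : ∃ ε : ℝ, 0 < ε ∧ ENNReal.ofReal ε ≤ e := by
      obtain ⟨e', h1, h2⟩ := ENNReal.lt_iff_exists_nnreal_btwn.1 he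
      exact ⟨e', by exact_mod_cast h1, by simpa using h2.le⟩
    refine ⟨ε, hε, hA.mono fun i hi g hg => ?_⟩
    exact hAB hi (y := ⟨g, hg.1, hg.2.1⟩) (htB (het (hg.2.2.trans hεe)))
  · rintro u ⟨C, hC⟩ ⟨K, hK⟩
    rw [Metric.tendsto_nhds]
    intro δ hδ
    obtain ⟨ε, hε, hcl⟩ := exists_uniform_lipschitz_closeness hd hf hp hfM hψ hE hS hC hK
      (half_pos hδ)
    have h1 := (Metric.tendsto_nhds.1 (h (BoundedContinuousFunction.mkOfBound
      ⟨u, hK.continuous⟩ C hC))) (δ / 2) (half_pos hδ)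
    filter_upwards [hnear hε, tendsto_fst.eventually h1,
      tendsto_fst.eventually (hm.eventually_ge_atTop 1)] with q hq1 hq2 hq3
    exact (abs_sub_le _ _ _).trans_lt
      ((add_lt_add (hcl q.2.1 hq1 (m q.1) hq3) hq2).trans_eq (add_halves δ))

/-- As `‖f‖_p < M` strictly, a density close enough to `f` in `L^p` satisfies the norm bound. -/
lemma exists_mem_densitiesNear_of_lt {f : Pt d → ℝ} (hf : IsProbDensity f) {p M : ℝ} (hp : 2 < p)
    (hfM : eLpNorm f (ENNReal.ofReal p) volume < ENNReal.ofReal M) :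
    ∃ δ : ℝ, 0 < δ ∧ ∀ ε : ℝ, ∀ g : Pt d → ℝ, IsProbDensity g →
      eLpNorm (fun x => g x - f x) (ENNReal.ofReal 1) volume < ENNReal.ofReal ε →
      eLpNorm (fun x => g x - f x) (ENNReal.ofReal p) volume < ENNReal.ofReal δ →
      g ∈ densitiesNear f p M ε := by
  have hsub : ENNReal.ofReal M - eLpNorm f (ENNReal.ofReal p) volume ≠ ∞ := by finiteness
  refine ⟨(ENNReal.ofReal M - eLpNorm f (ENNReal.ofReal p) volume).toReal,
    ENNReal.toReal_pos (tsub_pos_of_lt hfM).ne' hsub, fun ε g hg h1 hp' => ⟨hg, ?_, ?_⟩⟩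
  · rw [ENNReal.ofReal_toReal hsub] at hp'
    have hfm := hf.measurable
    have hgm := hg.measurable
    have hadd : g = (fun x => g x - f x) + f := by
      ext x
      simp
    rw [hadd]
    refine (eLpNorm_add_le (by fun_prop) (by fun_prop)
      (ENNReal.one_le_ofReal.2 (by linarith))).trans ?_
    calc _ ≤ (ENNReal.ofReal M - eLpNorm f (ENNReal.ofReal p) volume) +
          eLpNorm f (ENNReal.ofReal p) volume := by gcongr
      _ = ENNReal.ofReal M := tsub_add_cancel_of_le hfM.le
  · rw [ENNReal.ofReal_one, eLpNorm_one_eq_lintegral_enorm] at h1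
    refine le_trans (le_of_eq (lintegral_congr fun x => ?_)) h1.le
    rw [Real.enorm_eq_ofReal_abs, abs_sub_comm]

end WeakConvergence

/-! ### Random densities and the bootstrap -/

section Bootstrap

/-- A sequence tending to infinity that takes all large values has the same limits along it as the
full sequence of integers. -/
lemma map_atTop_eq_of_eventually_mem_range {m : ℕ → ℕ} (hm : Tendsto m atTop atTop)
    (h : ∀ᶠ N in atTop, N ∈ Set.range m) : map m atTop = atTop := by
  refine le_antisymm hm fun s hs => ?_
  obtain ⟨K, hK⟩ := mem_atTop_sets.1 (mem_map.1 hs)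
  filter_upwards [h, eventually_gt_atTop ((Finset.range K).sup m)] with N ⟨n, hn⟩ hN
  rw [← hn]
  refine hK n (not_lt.1 fun hlt => ?_)
  have := Finset.le_sup (f := m) (Finset.mem_range.2 hlt)
  omega

variable {Ω : Type*} [MeasurableSpace Ω] {P : Measure Ω} {d k : ℕ}
  {f : Pt d → ℝ} {p M : ℝ} {X : ℕ → Ω → Pt d} {fhat : (n : ℕ) → (Fin n → Pt d) → Pt d → ℝ}

lemma tendsto_measure_notMem_densitiesNear (hf : IsProbDensity f) (hp : 2 < p)
    (hfM : eLpNorm f (ENNReal.ofReal p) volume < ENNReal.ofReal M)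
    (hfhat : ∀ n, 1 ≤ n → ∀ᵐ ω ∂P, IsProbDensity (fhat n (firstObs X n ω)))
    (h1 : TendstoZeroInProb P (estError X fhat f 1))
    (h2 : TendstoZeroInProb P (estError X fhat f p)) {ε : ℝ} (hε : 0 < ε) :
    Tendsto (fun n => P {ω | fhat n (firstObs X n ω) ∉ densitiesNear f p M ε}) atTop (𝓝 0) := by
  obtain ⟨δ, hδ, hmem⟩ := exists_mem_densitiesNear_of_lt hf hp hfM
  have hlim : Tendsto (fun n => P {ω | ENNReal.ofReal ε ≤ estError X fhat f 1 n ω} +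
      P {ω | ENNReal.ofReal δ ≤ estError X fhat f p n ω}) atTop (𝓝 0) := by
    simpa using (h1 ε hε).add (h2 δ hδ)
  refine tendsto_of_tendsto_of_tendsto_of_le_of_le' tendsto_const_nhds hlim
    (Eventually.of_forall fun _ => zero_le) ?_
  filter_upwards [eventually_ge_atTop 1] with n hn
  have hnull : P {ω | ¬ IsProbDensity (fhat n (firstObs X n ω))} = 0 := ae_iff.1 (hfhat n hn)
  calc _ ≤ P (({ω | ENNReal.ofReal ε ≤ estError X fhat f 1 n ω} ∪
        {ω | ENNReal.ofReal δ ≤ estError X fhat f p n ω}) ∪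
          {ω | ¬ IsProbDensity (fhat n (firstObs X n ω))}) := by
        refine measure_mono fun ω hω => ?_
        by_contra hc
        simp only [Set.mem_union, Set.mem_ofPred_eq, not_or, not_le, not_not] at hc
        exact hω (hmem ε _ hc.2 hc.1.1 hc.1.2)
    _ ≤ _ := by
        refine (measure_union_le _ _).trans ?_
        rw [hnull, add_zero]
        exact measure_union_le _ _

lemma ae_eventually_mem_densitiesNear (hf : IsProbDensity f) (hp : 2 < p)
    (hfM : eLpNorm f (ENNReal.ofReal p) volume < ENNReal.ofReal M)
    (hfhat : ∀ n, 1 ≤ n → ∀ᵐ ω ∂P, IsProbDensity (fhat n (firstObs X n ω)))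
    (h1 : TendstoZeroAlmostSurely P (estError X fhat f 1))
    (h2 : TendstoZeroAlmostSurely P (estError X fhat f p)) :
    ∀ᵐ ω ∂P, ∀ ε : ℝ, 0 < ε →
      ∀ᶠ n in atTop, fhat n (firstObs X n ω) ∈ densitiesNear f p M ε := by
  obtain ⟨δ, hδ, hmem⟩ := exists_mem_densitiesNear_of_lt hf hp hfM
  have hall : ∀ᵐ ω ∂P, ∀ n, 1 ≤ n → IsProbDensity (fhat n (firstObs X n ω)) := by
    rw [ae_all_iff]
    intro n
    by_cases hn : 1 ≤ n
    · filter_upwards [hfhat n hn] with ω hω _ using hω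
    · exact ae_of_all _ fun ω h => absurd h hn
  filter_upwards [h1, h2, hall] with ω hω1 hω2 hω ε hε
  filter_upwards [hω1.eventually (gt_mem_nhds (ENNReal.ofReal_pos.2 hε)),
    hω2.eventually (gt_mem_nhds (ENNReal.ofReal_pos.2 hδ)), eventually_ge_atTop 1]
    with n hn1 hn2 hn
  exact hmem ε _ (hω n hn) hn1 hn2

variable {ψ : Multiset (Pt d) → (Fin k → ℝ)} {m : ℕ → ℕ} {G : Measure (Fin k → ℝ)}
  [IsProbabilityMeasure G]

theorem weakConvInProb_smoothedBootstrap_iff [IsProbabilityMeasure P] (hd : 1 ≤ d)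
    (hf : IsProbDensity f) (hp : 2 < p)
    (hfM : eLpNorm f (ENNReal.ofReal p) volume < ENNReal.ofReal M)
    (hfhat : ∀ n, 1 ≤ n → ∀ᵐ ω ∂P, IsProbDensity (fhat n (firstObs X n ω)))
    (hψ : Measurable ψ)
    (hE : ∀ j, MomentCondition (fun S => ψ S j) (densityClass d p M))
    (hS : ∀ j, StabilizationCondition (fun S => ψ S j) (densityClass d p M) (densityMeasure f)
      ((p - 2) / (d * (p - 1))))
    (hm : Tendsto m atTop atTop)
    (h1 : TendstoZeroInProb P (estError X fhat f 1))
    (h2 : TendstoZeroInProb P (estError X fhat f p)) :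
    (∀ v : (Fin k → ℝ) →ᵇ ℝ,
      Tendsto (fun i => ∫ y, v y ∂(bootstrapLaw ψ (m i) (densityMeasure f))) atTop
        (𝓝 (∫ y, v y ∂G))) ↔
      WeakConvInProb P (smoothedBootstrap ψ X fhat m) G := by
  constructor
  · intro h v
    refine tendstoInMeasure_of_ne_top fun e he he' => ?_
    obtain ⟨ε, hε, hev⟩ := exists_uniform_weak_closeness hd hf hp hfM.le hψ hE hS hm h v
      (ENNReal.toReal_pos he.ne' he')
    refine tendsto_of_tendsto_of_tendsto_of_le_of_le' tendsto_const_nhds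
      (tendsto_measure_notMem_densitiesNear hf hp hfM hfhat h1 h2 hε)
      (Eventually.of_forall fun _ => zero_le) ?_
    filter_upwards [hev] with n hn
    refine measure_mono fun ω hω hmem => ?_
    have h3 := hn _ hmem
    rw [← Real.dist_eq] at h3
    refine absurd (show e ≤ edist _ _ from hω) (not_le.2 ?_)
    rw [edist_dist, ← ENNReal.ofReal_toReal he']
    exact (ENNReal.ofReal_lt_ofReal_iff (ENNReal.toReal_pos he.ne' he')).2 h3
  · intro h
    refine tendsto_bootstrapLaw_of_forall_exists_near hd hf hp hfM.le hψ hE hS hm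
      fun v δ hδ ε hε => ?_
    have hlim := (tendsto_measure_notMem_densitiesNear hf hp hfM hfhat h1 h2 hε).add
      (h v (ENNReal.ofReal δ) (ENNReal.ofReal_pos.2 hδ))
    rw [add_zero] at hlim
    -- the exceptional events have total probability below one, so some outcome avoids them
    filter_upwards [hlim.eventually (gt_mem_nhds zero_lt_one)] with n hn
    obtain ⟨ω, hω⟩ : ∃ ω, ω ∉ {ω | fhat n (firstObs X n ω) ∉ densitiesNear f p M ε} ∪
        {ω | ENNReal.ofReal δ ≤ edist (∫ y, v y ∂(smoothedBootstrap ψ X fhat m n ω))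
          (∫ y, v y ∂G)} := by
      by_contra! hc
      have := (measure_union_le _ _).trans_lt hn
      rw [Set.eq_univ_of_forall hc, measure_univ] at this
      exact lt_irrefl _ this
    simp only [Set.mem_union, Set.mem_ofPred_eq, not_or, not_le, not_not] at hω
    refine ⟨_, hω.1, ?_⟩
    have h3 := hω.2
    rw [edist_dist, ENNReal.ofReal_lt_ofReal_iff hδ] at h3
    exact h3

theorem weakConvAlmostSurely_smoothedBootstrap_iff [IsProbabilityMeasure P] (hd : 1 ≤ d)
    (hf : IsProbDensity f) (hp : 2 < p) (hfM : eLpNorm f (ENNReal.ofReal p) volume < ENNReal.ofReal M)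
    (hfhat : ∀ n, 1 ≤ n → ∀ᵐ ω ∂P, IsProbDensity (fhat n (firstObs X n ω)))
    (hψ : Measurable ψ)
    (hE : ∀ j, MomentCondition (fun S => ψ S j) (densityClass d p M))
    (hS : ∀ j, StabilizationCondition (fun S => ψ S j) (densityClass d p M) (densityMeasure f)
      ((p - 2) / (d * (p - 1))))
    (hm : Tendsto m atTop atTop)
    (h1 : TendstoZeroAlmostSurely P (estError X fhat f 1))
    (h2 : TendstoZeroAlmostSurely P (estError X fhat f p)) :
    (∀ v : (Fin k → ℝ) →ᵇ ℝ,
      Tendsto (fun i => ∫ y, v y ∂(bootstrapLaw ψ (m i) (densityMeasure f))) atTop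
        (𝓝 (∫ y, v y ∂G))) ↔
      WeakConvAlmostSurely P (smoothedBootstrap ψ X fhat m) G := by
  have hnear := ae_eventually_mem_densitiesNear hf hp hfM hfhat h1 h2
  constructor
  · intro h
    filter_upwards [hnear] with ω hω v
    refine Metric.tendsto_nhds.2 fun δ hδ => ?_
    obtain ⟨ε, hε, hev⟩ := exists_uniform_weak_closeness hd hf hp hfM.le hψ hE hS hm h v hδ
    filter_upwards [hev, hω ε hε] with n hn hn' using hn _ hn'
  · intro h
    obtain ⟨ω, hω, hω'⟩ := (hnear.and h).exists
    refine tendsto_bootstrapLaw_of_forall_exists_near hd hf hp hfM.le hψ hE hS hm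
      fun v δ hδ ε hε => ?_
    filter_upwards [hω ε hε, (Metric.tendsto_nhds.1 (hω' v)) δ hδ] with n hn hn'
      using ⟨_, hn, hn'⟩

end Bootstrap

theorem theorem2p10
    {Ω : Type*} [MeasurableSpace Ω] (P : Measure Ω) [IsProbabilityMeasure P]
    (d k : ℕ) (hd : 1 ≤ d)
    -- the sampling distribution `F` and its density `f`
    (f : Pt d → ℝ) (hf : IsProbDensity f) (F : Measure (Pt d)) (hF : F = densityMeasure f)
    (p M : ℝ) (hp : 2 < p) (hM : eLpNorm f (ENNReal.ofReal p) volume < ENNReal.ofReal M)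
    -- the iid sample
    (X : ℕ → Ω → Pt d) (hX : ∀ i, Measurable (X i)) (hXF : ∀ i, P.map (X i) = F)
    (hXindep : iIndepFun X P)
    -- the density estimator, a function of the sample
    (fhat : (n : ℕ) → (Fin n → Pt d) → Pt d → ℝ)
    (hfhat_meas : ∀ n, Measurable (fun q : (Fin n → Pt d) × Pt d => fhat n q.1 q.2))
    (hfhat : ∀ n, 1 ≤ n → ∀ᵐ ω ∂P, IsProbDensity (fhat n (firstObs X n ω)))
    -- the statistic
    (ψ : Multiset (Pt d) → (Fin k → ℝ)) (hψ : Measurable ψ)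
    (hE : ∀ j, MomentCondition (fun S => ψ S j) (densityClass d p M))
    (hS : ∀ j, StabilizationCondition (fun S => ψ S j) (densityClass d p M) F
      ((p - 2) / (d * (p - 1))))
    -- the resample sizes and the limit law
    (m : ℕ → ℕ) (hm : Tendsto m atTop atTop)
    (G : Measure (Fin k → ℝ)) [IsProbabilityMeasure G] :
    -- convergence in probability
    (TendstoZeroInProb P (estError X fhat f 1) → TendstoZeroInProb P (estError X fhat f p) →
      (TendstoInDistribution (fun n => centredStat P ψ X n) atTop id (fun _ => P) G →
        WeakConvInProb P (smoothedBootstrap ψ X fhat m) G) ∧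
      (TendstoInDistribution (fun n => centredStat P ψ X (m n)) atTop id (fun _ => P) G ↔
        WeakConvInProb P (smoothedBootstrap ψ X fhat m) G) ∧
      ((∀ᶠ N in atTop, N ∈ Set.range m) →
        (TendstoInDistribution (fun n => centredStat P ψ X n) atTop id (fun _ => P) G ↔
          WeakConvInProb P (smoothedBootstrap ψ X fhat m) G))) ∧
    -- almost sure convergence
    (TendstoZeroAlmostSurely P (estError X fhat f 1) →
      TendstoZeroAlmostSurely P (estError X fhat f p) →
      (TendstoInDistribution (fun n => centredStat P ψ X n) atTop id (fun _ => P) G →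
        WeakConvAlmostSurely P (smoothedBootstrap ψ X fhat m) G) ∧
      (TendstoInDistribution (fun n => centredStat P ψ X (m n)) atTop id (fun _ => P) G ↔
        WeakConvAlmostSurely P (smoothedBootstrap ψ X fhat m) G) ∧
      ((∀ᶠ N in atTop, N ∈ Set.range m) →
        (TendstoInDistribution (fun n => centredStat P ψ X n) atTop id (fun _ => P) G ↔
          WeakConvAlmostSurely P (smoothedBootstrap ψ X fhat m) G))) := by
  subst hF
  have hT (m' : ℕ → ℕ) := tendstoInDistribution_centredStat_iff hX hXF hXindep hψ m' G
  have hmap (h : ∀ᶠ N in atTop, N ∈ Set.range m)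
      (hlim : TendstoInDistribution (fun n => centredStat P ψ X (m n)) atTop id (fun _ => P) G) :
      TendstoInDistribution (fun n => centredStat P ψ X n) atTop id (fun _ => P) G := by
    refine (hT fun n => n).2 fun v => ?_
    have h1 := (hT m).1 hlim v
    rwa [← map_atTop_eq_of_eventually_mem_range hm h, tendsto_map'_iff]
  have hcomp (hlim : TendstoInDistribution (fun n => centredStat P ψ X n) atTop id
      (fun _ => P) G) :
      TendstoInDistribution (fun n => centredStat P ψ X (m n)) atTop id (fun _ => P) G :=
    (hT m).2 fun v => ((hT fun n => n).1 hlim v).comp hm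
  refine ⟨fun h1 h2 => ?_, fun h1 h2 => ?_⟩
  · have hiff := (hT m).trans
      (weakConvInProb_smoothedBootstrap_iff hd hf hp hM hfhat hψ hE hS hm h1 h2)
    exact ⟨fun h => hiff.1 (hcomp h), hiff,
      fun hr => ⟨fun h => hiff.1 (hcomp h), fun h => hmap hr (hiff.2 h)⟩⟩
  · have hiff := (hT m).trans
      (weakConvAlmostSurely_smoothedBootstrap_iff hd hf hp hM hfhat hψ hE hS hm h1 h2)
    exact ⟨fun h => hiff.1 (hcomp h), hiff,
      fun hr => ⟨fun h => hiff.1 (hcomp h), fun h => hmap hr (hiff.2 h)⟩⟩
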